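/- There are $n$ bidders and one item. Bidder $i$ has a value in $[0,1]$ drawn from a distribution $D_i$, independently of the other bidders; put $D=D_1\times\dots\times D_n$. A mechanism $h$ maps a reported profile $v\in[0,1]^n$ to allocation probabilities and payments $p_i^h(v)$; its revenue on $v$ is $\mathrm{r}(h,v)=\sum_i p_i^h(v)$ and its expected revenue is $\mathrm{R}_D(h)=\mathbb{E}_{v\sim D}[\mathrm{r}(h,v)]$. Let $H$ be the class of all dominant strategy truthful, individually rational single-item mechanisms (with finite expected revenue). Let $H_{SP}$ be the class of second-price auctions with bidder-specific reserves $r\in[0,1]^n$: bidders with $v_i<r_i$ are removed, the highest remaining bidder wins (ties go to the smallest index) and pays the maximum of its own reserve and the bids of the other remaining bidders. Fix an ERM process for $H_{SP}$: on every finite sample (multiset) $T$ of profiles it outputs some $h_T\in H_{SP}$ that maximizes the empirical revenue $\frac1{|T|}\sum_{v\in T}\mathrm{r}(h,v)$ over $h\in H_{SP}$, and, whenever some maximizer has the property that each reserve $r_i$ equals the value of bidder $i$ in some profile of $T$, the output has this property. Let $\hat H_S=\{h_T: T\subseteq S,\ |T|=\lceil |S|/2\rceil\}$, where $h_T$ is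 identified with its vector of reserves, and let $\hat\tau(m)=\sup_{|S|=m}|\hat H_S|$ be the split-sample growth rate. Then for all $m\ge 1$: 1. $\hat\tau(m)\le m^n$. 2. If $S$ consists of $m$ i.i.d. profiles drawn from $D$, then $$\mathbb{E}_S[\mathrm{R}_D(h_S)]\ \ge\ \sup_{h\in H_{SP}}\mathrm{R}_D(h)-\sqrt{\frac{2n\log(2m)}{m}}.$$ 3. If moreover every $D_i$ is regular, i.e. its revenue curve $q\mapsto q\cdot v_i(q)$ is concave on $[0,1]$, where $v_i(q)=\sup\{p\in[0,1]:\Pr_{x\sim D_i}[x\ge p]\ge q\}$ (for a distribution with distribution function $F_i$ and positive density $f_i$ on an interval: the virtual value $v-\frac{1-F_i(v)}{f_i(v)}$ is nondecreasing), then $\sup_{h\in H_{SP}}\mathrm{R}_D(h)\ge\frac12\sup_{h\in H}\mathrm{R}_D(h)$ and $$\mathbb{E}_S[\mathrm{R}_D(h_S)]\ \ge\ \frac12\sup_{h\in H}\mathrm{R}_D(h)-\sqrt{\frac{2n\log(2m)}{m}}.$$ -/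

import Mathlib

open MeasureTheory
open scoped unitInterval

noncomputable section

/-! ### Empirical reward maximization and the split-sample growth rate -/

/-- The average reward of the hypothesis `h` on the finite sample `T` (a multiset, so that repeated
observations are counted with multiplicity). -/
def empiricalReward {H Z : Type*} (rew : H → Z → ℝ) (T : Multiset Z) (h : H) : ℝ :=
  (T.map (rew h)).sum / (Multiset.card T : ℝ)

/-- `erm` is an empirical reward maximization process: on every sample it outputs a hypothesis that
maximizes the empirical reward, ties being broken in a way that is fixed by `erm` itself. -/
def IsERM {H Z : Type*} (rew : H → Z → ℝ) (erm : Multiset Z → H) : Prop :=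
  ∀ T : Multiset Z, IsMaxOn (empiricalReward rew T) Set.univ (erm T)

/-- All hypotheses that `erm` outputs on sub-samples of `S` of size `⌈|S| / 2⌉`. -/
def splitSampleSpace {H Z : Type*} (erm : Multiset Z → H) (S : Multiset Z) : Set H :=
  {h | ∃ T : Multiset Z, T ≤ S ∧ Multiset.card T = ⌈(Multiset.card S : ℚ) / 2⌉₊ ∧ erm T = h}

/-- The largest size of the split-sample hypothesis space of a sample of size `m`. -/
def splitSampleGrowth {H Z : Type*} (erm : Multiset Z → H) (m : ℕ) : ℕ∞ :=
  ⨆ (S : Multiset Z) (_ : Multiset.card S = m), (splitSampleSpace erm S).encard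

/-- The sample of size `m` formed by the observations `z 0, …, z (m - 1)`. -/
def sampleOf {Z : Type*} {m : ℕ} (z : Fin m → Z) : Multiset Z :=
  Finset.univ.val.map z

/-! ### Single-item mechanisms -/

/-- Profiles of values (equivalently, of bids) of `n` bidders, each in `[0, 1]`. -/
abbrev Profile (n : ℕ) : Type := Fin n → I

/-- A direct mechanism for one item: the probability with which each bidder gets the item, and the
payment of each bidder, as functions of the reported profile. -/
structure Mechanism (n : ℕ) where
  alloc : Profile n → Fin n → ℝ
  pay : Profile n → Fin n → ℝ

namespace Mechanism

variable {n : ℕ}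

/-- The revenue of a mechanism on a profile: the sum of the payments. -/
def revenue (h : Mechanism n) (v : Profile n) : ℝ := ∑ i, h.pay v i

/-- The expected revenue of a mechanism when the profile of values has law `D`. -/
def expectedRevenue (D : Measure (Profile n)) (h : Mechanism n) : ℝ := ∫ v, h.revenue v ∂D

/-- Dominant strategy truthful, individually rational, feasible (measurable) single-item
mechanisms. Payments may be negative. -/
structure IsTruthful (h : Mechanism n) : Prop where
  measurable_alloc : ∀ i, Measurable fun v => h.alloc v i
  measurable_pay : ∀ i, Measurable fun v => h.pay v i
  alloc_nonneg : ∀ v i, 0 ≤ h.alloc v i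
  sum_alloc_le_one : ∀ v, ∑ i, h.alloc v i ≤ 1
  dominant_strategy : ∀ (i : Fin n) (v : Profile n) (b : I),
    (v i : ℝ) * h.alloc (Function.update v i b) i - h.pay (Function.update v i b) i
      ≤ (v i : ℝ) * h.alloc v i - h.pay v i
  individually_rational : ∀ (i : Fin n) (v : Profile n), 0 ≤ (v i : ℝ) * h.alloc v i - h.pay v i

/-- All truthful mechanisms whose expected revenue under `D` is defined and finite. -/
def truthfulClass (D : Measure (Profile n)) : Set (Mechanism n) :=
  {h | h.IsTruthful ∧ Integrable h.revenue D}

/-- The bidders whose bid meets their own reserve. -/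
def eligible (r : Fin n → I) (v : Profile n) : Finset (Fin n) :=
  Finset.univ.filter fun i => r i ≤ v i

/-- Bidder `i` wins the second-price auction with reserves `r`: it is eligible and has the highest
bid among the eligible bidders; ties go to the smallest index. -/
def Wins (r : Fin n → I) (v : Profile n) (i : Fin n) : Prop :=
  i ∈ eligible r v ∧ ∀ j ∈ eligible r v, v j < v i ∨ (v j = v i ∧ i ≤ j)

open Classical in
/-- The second-price auction with bidder-specific reserves `r`: bidders who bid less than their
reserve are removed, the highest remaining bidder gets the item and pays the maximum of its own
reserve and of the bids of the other remaining bidders. -/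
def secondPrice (r : Fin n → I) : Mechanism n where
  alloc v i := if Wins r v i then 1 else 0
  pay v i := if Wins r v i then ((r i ⊔ ((eligible r v).erase i).sup v : I) : ℝ) else 0

/-- All second-price auctions with bidder-specific reserves in `[0, 1]`. -/
def secondPriceClass (n : ℕ) : Set (Mechanism n) := Set.range (secondPrice (n := n))

end Mechanism

/-- The tie-breaking rule: whenever some optimal vector of reserves on the sample `T` consists of
values in the sample (the reserve of each bidder `i` being the value of bidder `i` in some profile
of `T`), the output on `T` is of this kind. -/
def FavorsSampleValues {n : ℕ} (erm : Multiset (Profile n) → (Fin n → I)) : Prop :=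
  ∀ T : Multiset (Profile n),
    (∃ r : Fin n → I,
      IsMaxOn (empiricalReward (fun r v => (Mechanism.secondPrice r).revenue v) T) Set.univ r ∧
        ∀ i, ∃ v ∈ T, r i = v i) →
    ∀ i, ∃ v ∈ T, erm T i = v i

/-! ### Regular distributions -/

/-- The value at quantile `q`: the highest price in `[0, 1]` at which a bidder with value
distribution `μ` buys with probability at least `q`. -/
def valueAtQuantile (μ : Measure I) (q : ℝ) : ℝ :=
  sSup {p : ℝ | p ∈ Set.Icc (0 : ℝ) 1 ∧ q ≤ μ.real {x : I | p ≤ (x : ℝ)}}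

/-- A distribution is regular if its revenue curve `q ↦ q * v(q)` in quantile space is concave.
If `μ` has a distribution function `F` and a positive density `f` on an interval, then the slope of
this curve at `q = 1 - F v` is the virtual value `v - (1 - F v) / f v`, so this says that the virtual
value is nondecreasing. The definition also covers such distributions when they are capped from
above, which creates an atom at the cap. -/
def IsRegularDistribution (μ : Measure I) : Prop :=
  ConcaveOn ℝ (Set.Icc (0 : ℝ) 1) fun q => q * valueAtQuantile μ q

end

/-! Growth and learning. Moving each reserve up to the least sample value of that bidder that meets
it never lowers the revenue on the sample, so the tie-breaking rule puts the output on the grid of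
sample values (`erm_mem_sample`). The grid of `m` profiles has at most `m ^ n` points. For
generalization, compare the training sample with an independent second sample of size `m`.
Exchanging the two profiles of any pairs preserves the joint law, and all outputs stay on the grid
of the `2 * m` pooled profiles. The gap between training and test reward thus becomes an average
over random signs of a sum selected from at most `(2 * m) ^ n` candidates, which Massart's lemma
`sum_signOf_le` bounds; `expected_erm_ge` assembles this.

The factor one half. A regular law has a nonnegative virtual value `ψ`
(`IsRegularDistribution.exists_virtualValue`), obtained as a Radon–Nikodym derivative, so atoms are
allowed and no density is needed. A bidder's expected payment in a truthful mechanism is at most its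
expected virtual surplus (`IsTruthful.lintegral_pay_le`). For the second-price auction with the
optimal reserves the two agree (`lintegral_secondPrice_pay`). On each profile a bidder with positive
virtual value either wins this auction or is an eligible loser, whose value is at most the price
paid (`virtualValue_le`). So the virtual surplus of any mechanism is at most the winner's virtual
value plus the revenue, and both terms integrate to the revenue of the auction. -/

namespace Mechanism

/-! ### Winner, price and revenue of second-price auctions -/

variable {n : ℕ} {r r' : Fin n → I} {v : Profile n} {i j : Fin n}

theorem mem_eligible : i ∈ eligible r v ↔ r i ≤ v i := by
  simp [eligible]

theorem Wins.eq (hi : Wins r v i) (hj : Wins r v j) : i = j := by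
  rcases hi.2 j hj.1 with h | ⟨h, hij⟩
  · rcases hj.2 i hi.1 with h' | ⟨h', -⟩
    · exact absurd (h.trans h') (lt_irrefl _)
    · exact absurd h (by rw [h']; exact lt_irrefl _)
  · rcases hj.2 i hi.1 with h' | ⟨-, hji⟩
    · exact absurd h' (by rw [h]; exact lt_irrefl _)
    · exact le_antisymm hij hji

theorem exists_wins (h : (eligible r v).Nonempty) : ∃ i, Wins r v i := by
  obtain ⟨i, hi, hmax⟩ := Finset.exists_max_image (eligible r v)
    (fun i => toLex (v i, OrderDual.toDual i)) h
  refine ⟨i, hi, fun j hj => ?_⟩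
  have := hmax j hj
  rw [Prod.Lex.toLex_le_toLex] at this
  simpa using this

/-- The price that the winner `i` pays. -/
noncomputable def price (r : Fin n → I) (v : Profile n) (i : Fin n) : I :=
  r i ⊔ ((eligible r v).erase i).sup v

theorem secondPrice_pay_of_wins (h : Wins r v i) :
    (secondPrice r).pay v i = (price r v i : ℝ) := by
  simp [secondPrice, price, h]

theorem secondPrice_pay_of_not_wins (h : ¬ Wins r v i) : (secondPrice r).pay v i = 0 := by
  simp [secondPrice, h]

theorem Wins.price_le (h : Wins r v i) : price r v i ≤ v i := by
  refine sup_le (mem_eligible.1 h.1) (Finset.sup_le fun j hj => ?_)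
  rcases h.2 j (Finset.mem_of_mem_erase hj) with h | h
  · exact h.le
  · exact h.1.le

theorem le_price (hj : j ∈ eligible r v) (hij : j ≠ i) : v j ≤ price r v i :=
  le_sup_of_le_right (Finset.le_sup (f := v) (Finset.mem_erase.2 ⟨hij, hj⟩))

theorem Wins.revenue_eq (h : Wins r v i) : (secondPrice r).revenue v = (price r v i : ℝ) := by
  rw [revenue, Finset.sum_eq_single i, secondPrice_pay_of_wins h]
  · exact fun j _ hj => secondPrice_pay_of_not_wins fun hw => hj (hw.eq h)
  · simp

theorem revenue_eq_zero (h : eligible r v = ∅) : (secondPrice r).revenue v = 0 :=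
  Finset.sum_eq_zero fun i _ => secondPrice_pay_of_not_wins fun hw => by
    simpa [h] using hw.1

theorem secondPrice_pay_nonneg : 0 ≤ (secondPrice r).pay v i := by
  by_cases h : Wins r v i
  · rw [secondPrice_pay_of_wins h]; exact (price r v i).2.1
  · rw [secondPrice_pay_of_not_wins h]

theorem secondPrice_revenue_nonneg : 0 ≤ (secondPrice r).revenue v :=
  Finset.sum_nonneg fun _ _ => secondPrice_pay_nonneg

theorem secondPrice_revenue_le_one : (secondPrice r).revenue v ≤ 1 := by
  rcases (eligible r v).eq_empty_or_nonempty with h | h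
  · rw [revenue_eq_zero h]; exact zero_le_one
  · obtain ⟨i, hi⟩ := exists_wins h
    rw [hi.revenue_eq]
    exact (price r v i).2.2

/-- Letting more bidders compete and raising the reserves of the bidders who meet them anyway does
not decrease the revenue. -/
theorem secondPrice_revenue_mono (hE : eligible r v ⊆ eligible r' v)
    (hr : ∀ i ∈ eligible r v, r i ≤ r' i) :
    (secondPrice r).revenue v ≤ (secondPrice r').revenue v := by
  rcases (eligible r v).eq_empty_or_nonempty with h | h
  · rw [revenue_eq_zero h]; exact secondPrice_revenue_nonneg
  · obtain ⟨i, hi⟩ := exists_wins h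
    obtain ⟨j, hj⟩ := exists_wins (h.mono hE)
    rw [hi.revenue_eq, hj.revenue_eq, Subtype.coe_le_coe]
    by_cases hij : i = j
    · subst hij
      exact sup_le_sup (hr i hi.1) (Finset.sup_mono (Finset.erase_subset_erase _ hE))
    -- The old winner still competes but loses, so the new price is at least its bid, hence at least
    -- the old price.
    · exact hi.price_le.trans (le_price (hE hi.1) hij)

/-! ### Measurability of second-price auctions -/

/-- Joint measurability in reserves and bids is needed because the learned reserves are themselves
random. -/
theorem measurableSet_wins (i : Fin n) :
    MeasurableSet {p : (Fin n → I) × Profile n | Wins p.1 p.2 i} := by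
  have hr (j : Fin n) : Measurable fun p : (Fin n → I) × Profile n => p.1 j :=
    (measurable_pi_apply j).comp measurable_fst
  have hv (j : Fin n) : Measurable fun p : (Fin n → I) × Profile n => p.2 j :=
    (measurable_pi_apply j).comp measurable_snd
  have : {p : (Fin n → I) × Profile n | Wins p.1 p.2 i} =
      {p | p.1 i ≤ p.2 i} ∩ ⋂ j, ({p | p.1 j ≤ p.2 j}ᶜ ∪
        ({p | p.2 j < p.2 i} ∪ ({p | p.2 j = p.2 i} ∩ {_p | i ≤ j}))) := by
    ext p
    simp only [Wins, mem_eligible, Set.mem_ofPred_eq, Set.mem_inter_iff, Set.mem_iInter,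
      Set.mem_union, Set.mem_compl_iff]
    refine and_congr_right fun _ => forall_congr' fun j => ?_
    tauto
  rw [this]
  exact (measurableSet_le (hr i) (hv i)).inter (MeasurableSet.iInter fun j =>
    (measurableSet_le (hr j) (hv j)).compl.union ((measurableSet_lt (hv j) (hv i)).union
      ((measurableSet_eq_fun (hv j) (hv i)).inter (MeasurableSet.const _))))

theorem measurable_price (i : Fin n) :
    Measurable fun p : (Fin n → I) × Profile n => price p.1 p.2 i := by
  have hr (j : Fin n) : Measurable fun p : (Fin n → I) × Profile n => p.1 j :=
    (measurable_pi_apply j).comp measurable_fst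
  have hv (j : Fin n) : Measurable fun p : (Fin n → I) × Profile n => p.2 j :=
    (measurable_pi_apply j).comp measurable_snd
  have : (fun p : (Fin n → I) × Profile n => price p.1 p.2 i) =
      fun p => p.1 i ⊔ (Finset.univ.erase i).sup
        (fun j => fun p : (Fin n → I) × Profile n => if p.1 j ≤ p.2 j then p.2 j else ⊥) p := by
    ext1 p
    rw [price, Finset.sup_apply]
    congr 1
    refine le_antisymm (Finset.sup_le fun j hj => ?_) (Finset.sup_le fun j hj => ?_)
    · rw [Finset.mem_erase, mem_eligible] at hj
      refine Finset.le_sup_of_le (Finset.mem_erase.2 ⟨hj.1, Finset.mem_univ j⟩) ?_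
      rw [if_pos hj.2]
    · split_ifs with h
      · exact Finset.le_sup (f := p.2)
          (Finset.mem_erase.2 ⟨(Finset.mem_erase.1 hj).1, mem_eligible.2 h⟩)
      · exact bot_le
  rw [this]
  refine (hr i).sup (Finset.sup_induction (p := Measurable) measurable_const
    (fun _ h _ h' => h.sup h') fun j _ => ?_)
  exact (hv j).ite (measurableSet_le (hr j) (hv j)) measurable_const

theorem measurable_secondPrice_pay (i : Fin n) :
    Measurable fun p : (Fin n → I) × Profile n => (secondPrice p.1).pay p.2 i := by
  classical
  exact (measurable_subtype_coe.comp (measurable_price i)).ite (measurableSet_wins i)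
    measurable_const

theorem measurable_secondPrice_revenue :
    Measurable fun p : (Fin n → I) × Profile n => (secondPrice p.1).revenue p.2 :=
  Finset.measurable_sum _ fun i _ => measurable_secondPrice_pay i

end Mechanism

/-! ### Optimal reserves can be taken from the sample -/

open Mechanism

theorem empiricalReward_mono {H Z : Type*} {rew : H → Z → ℝ} {T : Multiset Z} {h h' : H}
    (hle : ∀ z ∈ T, rew h z ≤ rew h' z) : empiricalReward rew T h ≤ empiricalReward rew T h' :=
  div_le_div_of_nonneg_right (Multiset.sum_map_le_sum_map _ _ hle) (Nat.cast_nonneg _)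

/-- Take the least sample value of bidder `i` that meets the reserve: the same sample profiles still
meet it. If none does, the condition is vacuous and any profile serves; the reserve may then go
down, which only adds competitors. -/
theorem exists_sample_reserve {n : ℕ} {T : Multiset (Profile n)} (hT : T ≠ 0) (r : Fin n → I)
    (i : Fin n) :
    ∃ v ∈ T, ∀ w ∈ T, r i ≤ w i → v i ≤ w i ∧ r i ≤ v i := by
  classical
  by_cases h : ∃ w ∈ T, r i ≤ w i
  · obtain ⟨v, hv, hmin⟩ := Finset.exists_min_image (T.toFinset.filter fun w => r i ≤ w i)
      (fun w => w i) (by obtain ⟨w, hw⟩ := h; exact ⟨w, by simpa using hw⟩)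
    simp only [Finset.mem_filter, Multiset.mem_toFinset] at hv hmin
    exact ⟨v, hv.1, fun w hw hrw => ⟨hmin w ⟨hw, hrw⟩, hv.2⟩⟩
  · obtain ⟨v, hv⟩ := Multiset.exists_mem_of_ne_zero hT
    exact ⟨v, hv, fun w hw hrw => absurd ⟨w, hw, hrw⟩ h⟩

theorem erm_mem_sample {n : ℕ} {erm : Multiset (Profile n) → (Fin n → I)}
    (hERM : IsERM (fun r v => (secondPrice r).revenue v) erm) (hTie : FavorsSampleValues erm)
    {T : Multiset (Profile n)} (hT : T ≠ 0) (i : Fin n) : ∃ v ∈ T, erm T i = v i := by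
  choose s hs hsr using exists_sample_reserve hT (erm T)
  refine hTie T ⟨fun i => s i i, fun r _ => ?_, fun i => ⟨s i, hs i, rfl⟩⟩ i
  refine (hERM T (Set.mem_univ r)).trans (empiricalReward_mono fun v hv => ?_)
  refine secondPrice_revenue_mono (fun i hi => ?_) fun i hi => ?_
  · exact mem_eligible.2 (hsr i v hv (mem_eligible.1 hi)).1
  · exact (hsr i v hv (mem_eligible.1 hi)).2

/-- The reserve vectors all of whose entries are values of the respective bidder in the sample. -/
noncomputable def sampleGrid {n : ℕ} (S : Multiset (Profile n)) : Finset (Fin n → I) :=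
  open Classical in Fintype.piFinset fun i => (S.map fun v => v i).toFinset

theorem card_sampleGrid_le {n : ℕ} (S : Multiset (Profile n)) :
    (sampleGrid S).card ≤ Multiset.card S ^ n := by
  classical
  rw [sampleGrid, Fintype.card_piFinset]
  refine (Finset.prod_le_pow_card _ _ (Multiset.card S) fun i _ => ?_).trans (by simp)
  exact (Multiset.toFinset_card_le _).trans (by simp)

theorem erm_mem_sampleGrid {n : ℕ} {erm : Multiset (Profile n) → (Fin n → I)}
    (hERM : IsERM (fun r v => (secondPrice r).revenue v) erm) (hTie : FavorsSampleValues erm)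
    {S T : Multiset (Profile n)} (hT : T ≠ 0) (hTS : T ≤ S) : erm T ∈ sampleGrid S := by
  classical
  rw [sampleGrid, Fintype.mem_piFinset]
  intro i
  obtain ⟨v, hv, h⟩ := erm_mem_sample hERM hTie hT i
  rw [Multiset.mem_toFinset, Multiset.mem_map]
  exact ⟨v, Multiset.mem_of_le hTS hv, h.symm⟩

theorem splitSampleGrowth_le {n : ℕ} {erm : Multiset (Profile n) → (Fin n → I)}
    (hERM : IsERM (fun r v => (secondPrice r).revenue v) erm) (hTie : FavorsSampleValues erm)
    {m : ℕ} (hm : 1 ≤ m) : splitSampleGrowth erm m ≤ (m : ℕ∞) ^ n := by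
  refine iSup₂_le fun S hS => ?_
  have hsub : splitSampleSpace erm S ⊆ (sampleGrid S : Set (Fin n → I)) := by
    rintro _ ⟨T, hTS, hcard, rfl⟩
    refine erm_mem_sampleGrid hERM hTie ?_ hTS
    rintro rfl
    -- The sub-sample must be nonempty, since on an empty one there are no values to use as
    -- reserves.
    have : 0 < ⌈(Multiset.card S : ℚ) / 2⌉₊ := Nat.ceil_pos.2 (by rw [hS]; positivity)
    simp only [Multiset.card_zero] at hcard
    omega
  refine (Set.encard_le_encard hsub).trans ?_
  rw [Set.encard_coe_eq_coe_finsetCard, ← hS]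
  exact_mod_cast card_sampleGrid_le S

/-! ### A maximal inequality for random signs -/

/-- The sign attached to a Boolean. -/
def signOf (b : Bool) : ℝ := if b then -1 else 1

/-- The exponential moment factors over the coordinates, and each factor is controlled by `cosh x ≤
exp (x ^ 2 / 2)`. -/
theorem sum_exp_signOf_le {m : ℕ} (a : Fin m → ℝ) (ha : ∀ t, |a t| ≤ 1) (l : ℝ) :
    ∑ ε : Fin m → Bool, Real.exp (l * ∑ t, signOf (ε t) * a t)
      ≤ 2 ^ m * Real.exp (l ^ 2 * m / 2) := by
  have h1 (ε : Fin m → Bool) : Real.exp (l * ∑ t, signOf (ε t) * a t) =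
      ∏ t, Real.exp (l * (signOf (ε t) * a t)) := by
    rw [Finset.mul_sum, Real.exp_sum]
  have h2 : ∑ ε : Fin m → Bool, ∏ t, Real.exp (l * (signOf (ε t) * a t)) =
      ∏ t, ∑ b : Bool, Real.exp (l * (signOf b * a t)) := by
    rw [Finset.prod_univ_sum, Fintype.piFinset_univ]
  have h3 (t : Fin m) : ∑ b : Bool, Real.exp (l * (signOf b * a t)) ≤ 2 * Real.exp (l ^ 2 / 2) := by
    have hc : ∑ b : Bool, Real.exp (l * (signOf b * a t)) = 2 * Real.cosh (l * a t) := by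
      rw [Fintype.sum_bool, Real.cosh_eq]
      simp only [signOf]
      norm_num
      ring
    rw [hc]
    refine mul_le_mul_of_nonneg_left ((Real.cosh_le_exp_half_sq _).trans ?_) zero_le_two
    have : a t ^ 2 ≤ 1 := by rw [← sq_abs]; exact pow_le_one₀ (abs_nonneg _) (ha t)
    refine Real.exp_le_exp.2 ?_
    nlinarith [sq_nonneg l]
  simp_rw [h1]
  rw [h2]
  refine (Finset.prod_le_prod (fun t _ => by positivity) fun t _ => h3 t).trans ?_
  rw [Finset.prod_const, mul_pow, ← Real.exp_nat_mul]
  simp only [Finset.card_univ, Fintype.card_fin]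
  apply le_of_eq
  congr 2
  ring

/-- Massart's finite class lemma: the average over all signs of a sum that is selected from a finite
family in a sign-dependent way. -/
theorem sum_signOf_le {H : Type*} {m : ℕ} (A : Finset H) {L : ℝ}
    (hA : (A.card : ℝ) ≤ Real.exp L) (a : H → Fin m → ℝ) (ha : ∀ h t, |a h t| ≤ 1)
    (f : (Fin m → Bool) → H) (hf : ∀ ε, f ε ∈ A) :
    (∑ ε : Fin m → Bool, ∑ t, signOf (ε t) * a (f ε) t) / 2 ^ m ≤ √(2 * L * m) := by
  set y : (Fin m → Bool) → ℝ := fun ε => ∑ t, signOf (ε t) * a (f ε) t with hy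
  have key (l : ℝ) : l * ((∑ ε, y ε) / 2 ^ m) ≤ L + l ^ 2 * m / 2 := by
    set K : ℝ := L + l ^ 2 * m / 2 with hK
    have h1 : ∑ ε, Real.exp (l * y ε) ≤ 2 ^ m * Real.exp K := by
      calc ∑ ε, Real.exp (l * y ε)
          ≤ ∑ ε, ∑ h ∈ A, Real.exp (l * ∑ t, signOf (ε t) * a h t) :=
            Finset.sum_le_sum fun ε _ => Finset.single_le_sum
              (f := fun h => Real.exp (l * ∑ t, signOf (ε t) * a h t))
              (fun h _ => (Real.exp_pos _).le) (hf ε)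
        _ = ∑ h ∈ A, ∑ ε : Fin m → Bool, Real.exp (l * ∑ t, signOf (ε t) * a h t) :=
            Finset.sum_comm
        _ ≤ ∑ h ∈ A, 2 ^ m * Real.exp (l ^ 2 * m / 2) :=
            Finset.sum_le_sum fun h _ => sum_exp_signOf_le _ (ha h) l
        _ = A.card * (2 ^ m * Real.exp (l ^ 2 * m / 2)) := by rw [Finset.sum_const, nsmul_eq_mul]
        _ ≤ Real.exp L * (2 ^ m * Real.exp (l ^ 2 * m / 2)) :=
            mul_le_mul_of_nonneg_right hA (by positivity)
        _ = 2 ^ m * Real.exp K := by rw [hK, Real.exp_add]; ring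
    -- The tangent line of `exp` at `K` replaces Jensen's inequality.
    have h2 (ε : Fin m → Bool) : l * y ε - K + 1 ≤ Real.exp (l * y ε) / Real.exp K := by
      rw [← Real.exp_sub]
      exact Real.add_one_le_exp _
    have h3 : ∑ ε : Fin m → Bool, (l * y ε - K + 1) ≤ 2 ^ m := by
      refine (Finset.sum_le_sum fun ε _ => h2 ε).trans ?_
      rw [← Finset.sum_div, div_le_iff₀ (Real.exp_pos _)]
      exact h1
    have hpos : (0 : ℝ) < 2 ^ m := by positivity
    rw [Finset.sum_add_distrib, Finset.sum_sub_distrib, ← Finset.mul_sum] at h3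
    simp only [Finset.sum_const, Finset.card_univ, Fintype.card_fun, Fintype.card_bool,
      Fintype.card_fin, nsmul_eq_mul, Nat.cast_pow, Nat.cast_ofNat] at h3
    rw [← mul_div_assoc, div_le_iff₀ hpos]
    linarith
  set x : ℝ := (∑ ε, y ε) / 2 ^ m
  rcases Nat.eq_zero_or_pos m with rfl | hm
  · have : x = 0 := by simp [x, hy]
    rw [this]
    positivity
  have hm' : (0 : ℝ) < m := Nat.cast_pos.2 hm
  refine Real.le_sqrt_of_sq_le ?_
  -- This `l` optimizes the bound `l * x - l ^ 2 * m / 2 ≤ L`.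
  have h := key (x / m)
  have e1 : x / m * x = x ^ 2 / m := by ring
  have e2 : (x / m) ^ 2 * m / 2 = x ^ 2 / m / 2 := by field_simp
  rw [e1, e2] at h
  have : x ^ 2 / m ≤ 2 * L := by linarith
  rwa [div_le_iff₀ hm'] at this

/-! ### Expected reward of empirical reward maximization -/

theorem sampleOf_eq_sum {Z : Type*} {m : ℕ} (z : Fin m → Z) :
    sampleOf z = ∑ t, ({z t} : Multiset Z) := by
  have := Multiset.sum_map_singleton (Finset.univ.val.map z)
  rw [Multiset.map_map] at this
  exact this.symm

theorem card_sampleOf {Z : Type*} {m : ℕ} (z : Fin m → Z) : Multiset.card (sampleOf z) = m := by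
  simp [sampleOf]

/-- Exchange the two observations at the indices selected by `ε`. -/
def swapAt {Z : Type*} {m : ℕ} (ε : Fin m → Bool) (w : Fin m → Z × Z) : Fin m → Z × Z :=
  fun t => if ε t then (w t).swap else w t

/-- This keeps the candidate hypotheses independent of the signs: every swapped training sample lies
in the same pooled sample. -/
theorem sampleOf_swapAt_le {Z : Type*} {m : ℕ} (ε : Fin m → Bool) (w : Fin m → Z × Z) :
    sampleOf (fun t => (swapAt ε w t).1) ≤
      sampleOf (fun t => (w t).1) + sampleOf (fun t => (w t).2) := by
  rw [sampleOf_eq_sum, sampleOf_eq_sum, sampleOf_eq_sum, ← Finset.sum_add_distrib]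
  refine Finset.sum_le_sum fun t _ => ?_
  by_cases h : ε t
  · simp [swapAt, h]
  · simp [swapAt, h]

theorem measurePreserving_swapAt {Z : Type*} [MeasurableSpace Z] (D : Measure Z)
    [IsProbabilityMeasure D] {m : ℕ} (ε : Fin m → Bool) :
    MeasurePreserving (swapAt ε) (Measure.pi fun _ : Fin m => D.prod D)
      (Measure.pi fun _ : Fin m => D.prod D) := by
  refine measurePreserving_pi _ _ (f := fun t (p : Z × Z) => if ε t then p.swap else p) fun t => ?_
  by_cases h : ε t
  · simpa [h] using Measure.measurePreserving_swap (μ := D) (ν := D)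
  · simpa [h, Function.id_def] using MeasurePreserving.id (D.prod D)

theorem empiricalReward_sampleOf {H Z : Type*} (rew : H → Z → ℝ) {m : ℕ} (z : Fin m → Z) (h : H) :
    empiricalReward rew (sampleOf z) h = (∑ t, rew h (z t)) / m := by
  rw [empiricalReward, card_sampleOf, sampleOf, Multiset.map_map]
  rfl

/-- Symmetrization with a second sample: the empirical maximizer beats `h` on the training sample,
so only the gap to the test sample has to be bounded. Randomly swapping pairs turns it into a
random-sign sum over the finite family `A`, which depends on the pooled sample only. -/
theorem expected_erm_ge {H Z : Type*} [MeasurableSpace H] [MeasurableSpace Z] (rew : H → Z → ℝ)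
    (hrew : Measurable fun p : H × Z => rew p.1 p.2) (h0 : ∀ h z, 0 ≤ rew h z)
    (h1 : ∀ h z, rew h z ≤ 1) (erm : Multiset Z → H) (hERM : IsERM rew erm) {m : ℕ} (hm : 1 ≤ m)
    (hMeas : Measurable fun S : Fin m → Z => erm (sampleOf S)) {L : ℝ}
    (hA : ∀ S : Multiset Z, Multiset.card S = 2 * m → ∃ A : Finset H, (A.card : ℝ) ≤ Real.exp L ∧
      ∀ T ≤ S, Multiset.card T = m → erm T ∈ A)
    (D : Measure Z) [IsProbabilityMeasure D] (h : H) :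
    ∫ z, rew h z ∂D - √(2 * L / m)
      ≤ ∫ S : Fin m → Z, ∫ z, rew (erm (sampleOf S)) z ∂D ∂(Measure.pi fun _ => D) := by
  have hm0 : (0 : ℝ) < m := by exact_mod_cast hm
  set P : Measure (Fin m → Z) := Measure.pi fun _ => D with hP
  set W : Measure (Fin m → Z × Z) := Measure.pi fun _ => D.prod D with hW
  have habs (h : H) (z : Z) : ‖rew h z‖ ≤ 1 := by
    rw [Real.norm_eq_abs, abs_le]; constructor <;> linarith [h0 h z, h1 h z]
  have hfst (t : Fin m) : Measurable fun w : Fin m → Z × Z => (w t).1 :=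
    measurable_fst.comp (measurable_pi_apply t)
  have hsnd (t : Fin m) : Measurable fun w : Fin m → Z × Z => (w t).2 :=
    measurable_snd.comp (measurable_pi_apply t)
  have hmF : Measurable fun w : Fin m → Z × Z => (fun t => (w t).1 : Fin m → Z) :=
    measurable_pi_lambda _ hfst
  have hmE : Measurable fun w : Fin m → Z × Z => erm (sampleOf fun t => (w t).1) :=
    hMeas.comp hmF
  have int1 (t : Fin m) : Integrable (fun w : Fin m → Z × Z =>
      rew (erm (sampleOf fun t => (w t).1)) (w t).1) W :=
    Integrable.of_bound (hrew.comp (hmE.prodMk (hfst t))).aestronglyMeasurable 1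
      (Filter.Eventually.of_forall fun w => habs _ _)
  have int2 (t : Fin m) : Integrable (fun w : Fin m → Z × Z =>
      rew (erm (sampleOf fun t => (w t).1)) (w t).2) W :=
    Integrable.of_bound (hrew.comp (hmE.prodMk (hsnd t))).aestronglyMeasurable 1
      (Filter.Eventually.of_forall fun w => habs _ _)
  -- the reward on the training sample
  have train : ∫ z, rew h z ∂D ≤
      ∫ w, (∑ t, rew (erm (sampleOf fun t => (w t).1)) (w t).1) / m ∂W := by
    have e (t : Fin m) : ∫ w : Fin m → Z × Z, rew h (w t).1 ∂W = ∫ z, rew h z ∂D := by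
      have hp : MeasurePreserving (fun w : Fin m → Z × Z => (w t).1) W D :=
        measurePreserving_fst.comp (measurePreserving_eval _ t)
      rw [← hp.map_eq, integral_map hp.measurable.aemeasurable]
      exact (hrew.comp (measurable_const.prodMk measurable_id)).aestronglyMeasurable
    have inth (t : Fin m) : Integrable (fun w : Fin m → Z × Z => rew h (w t).1) W :=
      Integrable.of_bound (hrew.comp (measurable_const.prodMk (hfst t))).aestronglyMeasurable 1
        (Filter.Eventually.of_forall fun w => habs _ _)
    calc ∫ z, rew h z ∂D = ∫ w : Fin m → Z × Z, (∑ t, rew h (w t).1) / m ∂W := by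
          rw [integral_div, integral_finsetSum _ fun t _ => inth t]
          simp_rw [e]
          rw [Finset.sum_const, Finset.card_univ, Fintype.card_fin, nsmul_eq_mul]
          field_simp
      _ ≤ _ := by
          refine integral_mono ((integrable_finsetSum _ fun t _ => inth t).div_const _)
            ((integrable_finsetSum _ fun t _ => int1 t).div_const _) fun w => ?_
          have := hERM (sampleOf fun t => (w t).1) (Set.mem_univ h)
          simpa only [Set.mem_ofPred_eq, empiricalReward_sampleOf] using this
  -- the reward on the test sample
  have test : ∫ S, ∫ z, rew (erm (sampleOf S)) z ∂D ∂P =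
      ∫ w, (∑ t, rew (erm (sampleOf fun t => (w t).1)) (w t).2) / m ∂W := by
    have e (t : Fin m) : ∫ w : Fin m → Z × Z, rew (erm (sampleOf fun t => (w t).1)) (w t).2 ∂W =
        ∫ S, ∫ z, rew (erm (sampleOf S)) z ∂D ∂P := by
      have hp : MeasurePreserving
          (fun w : Fin m → Z × Z => ((fun s => (w s).1 : Fin m → Z), (w t).2)) W (P.prod D) :=
        ((MeasurePreserving.id P).prod (measurePreserving_eval (fun _ : Fin m => D) t)).comp
          (measurePreserving_arrowProdEquivProdArrow Z Z (Fin m) (fun _ => D) (fun _ => D))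
      have hmeas : Measurable fun q : (Fin m → Z) × Z => rew (erm (sampleOf q.1)) q.2 :=
        hrew.comp ((hMeas.comp measurable_fst).prodMk measurable_snd)
      rw [← integral_prod (fun q : (Fin m → Z) × Z => rew (erm (sampleOf q.1)) q.2)
        (Integrable.of_bound hmeas.aestronglyMeasurable 1
          (Filter.Eventually.of_forall fun w => habs _ _)), ← hp.map_eq,
        integral_map hp.measurable.aemeasurable hmeas.aestronglyMeasurable]
    rw [integral_div, integral_finsetSum _ fun t _ => int2 t]
    simp_rw [e]
    rw [Finset.sum_const, Finset.card_univ, Fintype.card_fin, nsmul_eq_mul]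
    field_simp
  set G : (Fin m → Z × Z) → ℝ := fun w => ∑ t,
    (rew (erm (sampleOf fun t => (w t).1)) (w t).1 -
      rew (erm (sampleOf fun t => (w t).1)) (w t).2) with hG
  have intG : Integrable G W := integrable_finsetSum _ fun t _ => (int1 t).sub (int2 t)
  have gap : ∫ z, rew h z ∂D - ∫ S, ∫ z, rew (erm (sampleOf S)) z ∂D ∂P ≤ (∫ w, G w ∂W) / m := by
    rw [test, ← integral_div]
    refine (sub_le_sub_right train _).trans (le_of_eq ?_)
    rw [← integral_sub ((integrable_finsetSum _ fun t _ => int1 t).div_const _)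
      ((integrable_finsetSum _ fun t _ => int2 t).div_const _)]
    congr 1
    ext w
    rw [hG, ← sub_div, ← Finset.sum_sub_distrib]
  have intS (ε : Fin m → Bool) : Integrable (fun w => G (swapAt ε w)) W :=
    (measurePreserving_swapAt D ε).integrable_comp_of_integrable intG
  have swap : ∫ w, G w ∂W = ∫ w, (∑ ε : Fin m → Bool, G (swapAt ε w)) / 2 ^ m ∂W := by
    have hp (ε : Fin m → Bool) := measurePreserving_swapAt D ε
    have e (ε : Fin m → Bool) : ∫ w, G (swapAt ε w) ∂W = ∫ w, G w ∂W := by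
      conv_rhs => rw [hW, ← (hp ε).map_eq]
      rw [integral_map (hp ε).measurable.aemeasurable]
      rw [(hp ε).map_eq]
      exact intG.aestronglyMeasurable
    rw [integral_div, integral_finsetSum _ fun ε _ => intS ε,
      Finset.sum_congr rfl fun ε _ => e ε]
    simp
  have massart (w : Fin m → Z × Z) :
      (∑ ε : Fin m → Bool, G (swapAt ε w)) / 2 ^ m ≤ √(2 * L * m) := by
    obtain ⟨A, hcard, hmem⟩ := hA (sampleOf (fun t => (w t).1) + sampleOf (fun t => (w t).2))
      (by rw [Multiset.card_add, card_sampleOf, card_sampleOf]; ring)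
    refine le_of_eq_of_le ?_ (sum_signOf_le A hcard
      (fun h t => rew h (w t).1 - rew h (w t).2) (fun h t => ?_)
      (fun ε => erm (sampleOf fun t => (swapAt ε w t).1))
      fun ε => hmem _ (sampleOf_swapAt_le ε w) (card_sampleOf _))
    -- Swapping pair `t` reverses the sign of its training-minus-test difference; the output enters
    -- only through the selected hypothesis.
    · congr 1
      refine Finset.sum_congr rfl fun ε _ => Finset.sum_congr rfl fun t _ => ?_
      by_cases hε : ε t
      · have : swapAt ε w t = (w t).swap := by simp [swapAt, hε]
        simp only [this, signOf, hε]
        simp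
      · have : swapAt ε w t = w t := by simp [swapAt, hε]
        simp only [this, signOf, hε]
        simp
    · rw [abs_le]
      constructor <;> linarith [h0 h (w t).1, h0 h (w t).2, h1 h (w t).1, h1 h (w t).2]
  have bound : ∫ w, G w ∂W ≤ √(2 * L * m) := by
    rw [swap]
    refine (integral_mono (g := fun _ => √(2 * L * m)) ?_ (integrable_const _) massart).trans ?_
    · exact (integrable_finsetSum _ fun ε _ => intS ε).div_const _
    · simp
  have hs : √(2 * L * m) / m = √(2 * L / m) := by
    rw [show 2 * L / (m : ℝ) = 2 * L * m / m ^ 2 by field_simp, Real.sqrt_div' _ (by positivity),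
      Real.sqrt_sq hm0.le]
  have := div_le_div_of_nonneg_right bound hm0.le
  rw [hs] at this
  linarith

/-! ### Learning reserves from samples -/

open Mechanism

theorem expectedRevenue_erm_ge {n : ℕ} {erm : Multiset (Profile n) → (Fin n → I)}
    (hERM : IsERM (fun r v => (secondPrice r).revenue v) erm) (hTie : FavorsSampleValues erm)
    {m : ℕ} (hm : 1 ≤ m) (hMeas : Measurable fun S : Fin m → Profile n => erm (sampleOf S))
    (D : Measure (Profile n)) [IsProbabilityMeasure D] :
    sSup (expectedRevenue D '' secondPriceClass n) - √(2 * n * Real.log (2 * m) / m)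
      ≤ ∫ S : Fin m → Profile n, expectedRevenue D (secondPrice (erm (sampleOf S)))
          ∂(Measure.pi fun _ => D) := by
  rw [sub_le_iff_le_add]
  refine csSup_le ((Set.range_nonempty _).image _) ?_
  rintro _ ⟨_, ⟨r, rfl⟩, rfl⟩
  rw [← sub_le_iff_le_add]
  have hm0 : (0 : ℝ) < m := by exact_mod_cast hm
  -- With this `L`, `exp L = (2 * m) ^ n` is the grid bound for the pooled sample.
  have := expected_erm_ge (fun r v => (secondPrice r).revenue v) measurable_secondPrice_revenue
    (fun _ _ => secondPrice_revenue_nonneg) (fun _ _ => secondPrice_revenue_le_one) erm hERM hm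
    hMeas (L := n * Real.log (2 * m)) (fun S hS => ⟨sampleGrid S, ?_, fun T hT hTm => ?_⟩) D r
  · rwa [← mul_assoc] at this
  · rw [← Real.log_pow, Real.exp_log (by positivity)]
    have := card_sampleGrid_le S
    rw [hS] at this
    exact_mod_cast this
  · refine erm_mem_sampleGrid hERM hTie ?_ hT
    rintro rfl
    simp at hTm
    omega

/-! ### Measures on the line from left-continuous monotone functions -/

open Set Filter Topology in
-- Reflecting the line turns `f` into a right-continuous Stieltjes function and half-open intervals
-- `Ioc` into `Ico`.
theorem exists_measure_Ico_eq {f : ℝ → ℝ} (hf : Monotone f)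
    (hc : ∀ t, ContinuousWithinAt f (Iic t) t) :
    ∃ ν : Measure ℝ, ∀ a b, ν (Ico a b) = ENNReal.ofReal (f b - f a) := by
  let g : StieltjesFunction ℝ :=
    { toFun := fun x => -f (-x)
      mono' := fun x y h => neg_le_neg (hf (neg_le_neg h))
      right_continuous' := fun x =>
        ((hc (-x)).comp continuousWithinAt_neg fun y hy => neg_le_neg (mem_Ici.1 hy)).neg }
  refine ⟨g.measure.map Neg.neg, fun a b => ?_⟩
  have hg (x : ℝ) : g x = -f (-x) := rfl
  rw [Measure.map_apply measurable_neg measurableSet_Ico, neg_preimage, neg_Ico, g.measure_Ioc, hg,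
    hg, neg_neg, neg_neg, neg_sub_neg]

open Set Filter Topology in
theorem tendsto_measure_Iio (ξ : Measure ℝ) [IsFiniteMeasure ξ] (t : ℝ) :
    Tendsto (fun s => ξ (Iio s)) (𝓝[≤] t) (𝓝 (ξ (Iio t))) := by
  refine tendsto_measure_of_tendsto_indicator_of_isFiniteMeasure _ ξ (fun _ => measurableSet_Iio)
    fun x => ?_
  by_cases h : x < t
  · filter_upwards [mem_nhdsWithin_of_mem_nhds (lt_mem_nhds h)] with s hs
    simp [hs, h]
  · filter_upwards [self_mem_nhdsWithin] with s hs
    simp only [mem_Iio, h, iff_false, not_lt]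
    exact (mem_Iic.1 hs).trans (not_lt.1 h)

open Set Filter Topology in
theorem continuousWithinAt_measureReal_Iio (ξ : Measure ℝ) [IsFiniteMeasure ξ] (t : ℝ) :
    ContinuousWithinAt (fun s => ξ.real (Iio s)) (Iic t) t :=
  (ENNReal.tendsto_toReal (measure_ne_top _ _)).comp (tendsto_measure_Iio ξ t)

theorem measureReal_Ico_eq (ξ : Measure ℝ) [IsFiniteMeasure ξ] {a b : ℝ} (hab : a ≤ b) :
    ξ.real (Set.Ico a b) = ξ.real (Set.Iio b) - ξ.real (Set.Iio a) := by
  rw [← measureReal_sdiff (Set.Iio_subset_Iio hab) measurableSet_Iio]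
  congr 1
  ext x
  simp

open Set in
-- The difference between the distribution function of `ξ` and `f` is again monotone and
-- left-continuous, so it defines a complementary measure `η` with `ξ = ν + η`. This extends the
-- domination from intervals to all sets.
theorem exists_measure_le_Ico_eq (ξ : Measure ℝ) [IsFiniteMeasure ξ] {f : ℝ → ℝ} (hf : Monotone f)
    (hc : ∀ t, ContinuousWithinAt f (Iic t) t)
    (hle : ∀ a b, a < b → ENNReal.ofReal (f b - f a) ≤ ξ (Ico a b)) :
    ∃ ν : Measure ℝ, ν ≤ ξ ∧ ∀ a b, ν (Ico a b) = ENNReal.ofReal (f b - f a) := by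
  have hle' (a b : ℝ) (hab : a < b) : f b - f a ≤ ξ.real (Iio b) - ξ.real (Iio a) := by
    rw [← measureReal_Ico_eq ξ hab.le]
    exact (ENNReal.ofReal_le_iff_le_toReal (measure_ne_top _ _)).1 (hle a b hab)
  have hg : Monotone fun t => ξ.real (Iio t) - f t := by
    intro a b hab
    rcases hab.eq_or_lt with rfl | hab
    · exact le_rfl
    · have := hle' a b hab
      simp only
      linarith
  obtain ⟨ν, hν⟩ := exists_measure_Ico_eq hf hc
  obtain ⟨η, hη⟩ := exists_measure_Ico_eq hg fun t =>
    (continuousWithinAt_measureReal_Iio ξ t).sub (hc t)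
  refine ⟨ν, ?_, hν⟩
  have : ξ = ν + η := by
    refine Measure.ext_of_Ico ξ (ν + η) fun a b hab => ?_
    rw [Measure.add_apply, hν, hη, ← ENNReal.ofReal_add (sub_nonneg.2 (hf hab.le))
      (sub_nonneg.2 (hg hab.le)), ← ENNReal.ofReal_toReal (measure_ne_top ξ (Ico a b))]
    congr 1
    have := measureReal_Ico_eq ξ hab.le
    rw [Measure.real] at this
    rw [this]
    ring
  rw [this]
  exact Measure.le_add_right le_rfl

/-! ### Posted prices and regular distributions -/

/-- `ψ` is a nonnegative virtual value for the value distribution `μ` with the optimal reserve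
`r`. -/
structure IsVirtualValue (μ : Measure I) (r : I) (ψ : I → ENNReal) : Prop where
  measurable : Measurable ψ
  le_value : ∀ x, ψ x ≤ ENNReal.ofReal x
  eq_zero : ∀ x < r, ψ x = 0
  setLIntegral_Ici : ∀ θ, r ≤ θ →
    ∫⁻ x in Set.Ici θ, ψ x ∂μ = ENNReal.ofReal θ * μ (Set.Ici θ)
  optimal : ∀ θ : I, ENNReal.ofReal θ * μ (Set.Ici θ) ≤ ENNReal.ofReal r * μ (Set.Ici r)

/-- The probability that a bidder with value distribution `μ` buys at the price `t`. -/
noncomputable def saleProb (μ : Measure I) (t : ℝ) : ℝ := μ.real {x : I | t ≤ (x : ℝ)}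

section saleProb

open Set Filter Topology

variable (μ : Measure I)

theorem saleProb_nonneg (t : ℝ) : 0 ≤ saleProb μ t := measureReal_nonneg

theorem saleProb_of_one_lt {t : ℝ} (ht : 1 < t) : saleProb μ t = 0 := by
  have : {x : I | t ≤ (x : ℝ)} = ∅ :=
    eq_empty_of_forall_notMem fun x hx => absurd (ht.trans_le (hx.trans x.2.2)) (lt_irrefl _)
  rw [saleProb, this, measureReal_empty]

theorem le_valueAtQuantile {p q : ℝ} (hp : p ∈ Icc (0 : ℝ) 1) (h : q ≤ saleProb μ p) :
    p ≤ valueAtQuantile μ q :=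
  le_csSup ⟨1, fun _ hx => hx.1.2⟩ ⟨hp, h⟩

variable [IsProbabilityMeasure μ]

theorem saleProb_le_one (t : ℝ) : saleProb μ t ≤ 1 := measureReal_le_one

theorem saleProb_antitone : Antitone (saleProb μ) := fun _ _ hst =>
  measureReal_mono fun _ hx => hst.trans hx

theorem saleProb_zero : saleProb μ 0 = 1 := by
  have : {x : I | (0 : ℝ) ≤ (x : ℝ)} = univ := eq_univ_of_forall fun x => x.2.1
  rw [saleProb, this, probReal_univ]

theorem saleProb_eq (t : ℝ) :
    saleProb μ t = 1 - (μ.map ((↑) : I → ℝ)).real (Iio t) := by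
  have : {x : I | t ≤ (x : ℝ)} = (((↑) : I → ℝ) ⁻¹' Iio t)ᶜ := by
    ext x
    simp
  rw [map_measureReal_apply measurable_subtype_coe measurableSet_Iio, saleProb, this,
    probReal_compl_eq_one_sub (measurable_subtype_coe measurableSet_Iio)]

theorem continuousWithinAt_saleProb (t : ℝ) : ContinuousWithinAt (saleProb μ) (Iic t) t := by
  have : IsProbabilityMeasure (μ.map ((↑) : I → ℝ)) :=
    Measure.isProbabilityMeasure_map measurable_subtype_coe.aemeasurable
  have e : saleProb μ = fun t => 1 - (μ.map ((↑) : I → ℝ)).real (Iio t) :=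
    funext (saleProb_eq μ)
  rw [e]
  exact continuousWithinAt_const.sub (continuousWithinAt_measureReal_Iio _ t)

theorem exists_lt_saleProb_lt {t y : ℝ} (h : saleProb μ t < y) :
    ∃ s < t, saleProb μ s < y := by
  have := ((continuousWithinAt_saleProb μ t).eventually_lt_const h).filter_mono
    (nhdsWithin_mono t Iio_subset_Iic_self)
  obtain ⟨s, hs, hs'⟩ := (this.and self_mem_nhdsWithin).exists
  exact ⟨s, hs', hs⟩

/-- Atoms make the revenue discontinuous, but the sale probability is antitone and left-continuous:
its value at a price just below `t` bounds it near `t`. Upper semicontinuity is enough for an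
optimal price to exist. -/
theorem upperSemicontinuousOn_mul_saleProb :
    UpperSemicontinuousOn (fun t => t * saleProb μ t) (Icc 0 1) := by
  intro t ht y hy
  obtain ⟨s, hst, hs⟩ : ∃ s < t, t * saleProb μ s < y := by
    rcases ht.1.eq_or_lt with h0 | h0
    · exact ⟨t - 1, by linarith, by rw [← h0] at hy ⊢; simpa using hy⟩
    · obtain ⟨s, hst, hs⟩ := exists_lt_saleProb_lt μ (t := t) (y := y / t)
        (by rw [lt_div_iff₀ h0, mul_comm]; exact hy)
      exact ⟨s, hst, by rwa [lt_div_iff₀ h0, mul_comm] at hs⟩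
  have h1 : ∀ᶠ u in 𝓝 t, u * saleProb μ s < y :=
    (continuous_id.mul continuous_const).continuousAt.eventually_lt_const hs
  filter_upwards [mem_nhdsWithin_of_mem_nhds h1, mem_nhdsWithin_of_mem_nhds (lt_mem_nhds hst),
    self_mem_nhdsWithin] with u hu hsu hu01
  exact (mul_le_mul_of_nonneg_left (saleProb_antitone μ hsu.le) hu01.1).trans_lt hu

theorem exists_optimal_price :
    ∃ r : I, ∀ t : I, (t : ℝ) * saleProb μ t ≤ r * saleProb μ r := by
  obtain ⟨r, hr, hmax⟩ := (upperSemicontinuousOn_mul_saleProb μ).exists_isMaxOn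
    ⟨0, by simp⟩ isCompact_Icc
  exact ⟨⟨r, hr⟩, fun t => hmax t.2⟩

theorem valueAtQuantile_mem {q : ℝ} (hq : q ≤ 1) : valueAtQuantile μ q ∈ Icc (0 : ℝ) 1 :=
  ⟨le_valueAtQuantile μ (by simp) (by rwa [saleProb_zero]),
    csSup_le ⟨0, by simp, hq.trans (saleProb_zero μ).ge⟩ fun _ hx => hx.1.2⟩

/-- Left continuity makes the supremum in the definition attained. -/
theorem le_saleProb_valueAtQuantile {q : ℝ} (hq : q ≤ 1) :
    q ≤ saleProb μ (valueAtQuantile μ q) := by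
  by_contra! h
  obtain ⟨s, hs, hsq⟩ := exists_lt_saleProb_lt μ h
  obtain ⟨p, hp, hsp⟩ := exists_lt_of_lt_csSup
    (⟨0, by simp, hq.trans (saleProb_zero μ).ge⟩ : Set.Nonempty {p : ℝ | p ∈ Icc (0 : ℝ) 1 ∧
      q ≤ μ.real {x : I | p ≤ (x : ℝ)}}) hs
  exact absurd (hp.2.trans (saleProb_antitone μ hsp.le)) (not_le.2 hsq)

/-- Above an optimal price, the revenue from a regular distribution decreases in the price. -/
theorem IsRegularDistribution.mul_saleProb_antitone (hμ : IsRegularDistribution μ) {r : I}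
    (hr : ∀ t : I, (t : ℝ) * saleProb μ t ≤ r * saleProb μ r) {a b : ℝ} (hra : r ≤ a)
    (hab : a ≤ b) (hb : b ≤ 1) : b * saleProb μ b ≤ a * saleProb μ a := by
  have hr0 : (0 : ℝ) ≤ r := r.2.1
  have ha01 : a ∈ Icc (0 : ℝ) 1 := ⟨hr0.trans hra, hab.trans hb⟩
  have hb01 : b ∈ Icc (0 : ℝ) 1 := ⟨ha01.1.trans hab, hb⟩
  set R : ℝ → ℝ := fun q => q * valueAtQuantile μ q with hR
  set qr := saleProb μ r with hqr
  have hqr01 : qr ∈ Icc (0 : ℝ) 1 := ⟨saleProb_nonneg μ _, saleProb_le_one μ _⟩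
  have hmax {q : ℝ} (hq : q ∈ Icc (0 : ℝ) 1) : R q ≤ R qr := by
    have hv := valueAtQuantile_mem μ hq.2
    calc R q ≤ saleProb μ (valueAtQuantile μ q) * valueAtQuantile μ q :=
          mul_le_mul_of_nonneg_right (le_saleProb_valueAtQuantile μ hq.2) hv.1
      _ ≤ r * qr := by rw [mul_comm]; exact hr ⟨_, hv⟩
      _ ≤ R qr := by
          rw [mul_comm]
          exact mul_le_mul_of_nonneg_left (le_valueAtQuantile μ r.2 le_rfl) hqr01.1
  -- A concave curve that is maximal at `qr` increases to the left of `qr`.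
  have hmono {q q' : ℝ} (h0 : 0 ≤ q) (hqq : q ≤ q') (hq' : q' ≤ qr) : R q ≤ R q' := by
    have hq01 : q ∈ Icc (0 : ℝ) 1 := ⟨h0, (hqq.trans hq').trans hqr01.2⟩
    have := hμ.min_le_of_mem_Icc hq01 hqr01 ⟨hqq, hq'⟩
    rwa [min_eq_left (hmax hq01)] at this
  set qa := saleProb μ a with hqa
  have hqa01 : qa ∈ Icc (0 : ℝ) 1 := ⟨saleProb_nonneg μ _, saleProb_le_one μ _⟩
  have hqaqr : qa ≤ qr := saleProb_antitone μ hra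
  have hba : saleProb μ b ≤ qa := saleProb_antitone μ hab
  have h1 : b * saleProb μ b ≤ R qa := by
    refine le_trans ?_ (hmono (saleProb_nonneg μ b) hba hqaqr)
    rw [mul_comm]
    exact mul_le_mul_of_nonneg_left (le_valueAtQuantile μ hb01 le_rfl) (saleProb_nonneg μ b)
  refine h1.trans ?_
  rcases hqa01.1.eq_or_lt with h0 | h0
  · simp [hR, ← h0]
  rw [hR]
  simp only
  rw [mul_comm]
  refine mul_le_mul_of_nonneg_right ?_ hqa01.1
  set c := valueAtQuantile μ qa with hc
  have hc01 := valueAtQuantile_mem μ hqa01.2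
  -- If `c` exceeded `a`, then for `qa = qr` the price `c` would beat the optimum. For `qa < qr`,
  -- quantiles just above `qa` have value at most `a`, so monotonicity of `R` and `q → qa` force `c
  -- ≤ a`.
  by_contra! hac
  rcases hqaqr.eq_or_lt with heq | hlt
  · have hcq := le_saleProb_valueAtQuantile μ hqa01.2
    have h2 := hr ⟨c, hc01⟩
    have h3 : c * qa ≤ c * saleProb μ c := mul_le_mul_of_nonneg_left hcq hc01.1
    have h4 : a * qa < c * qa := mul_lt_mul_of_pos_right hac h0
    have h5 : r * qr ≤ a * qa := by rw [heq]; exact mul_le_mul_of_nonneg_right hra hqr01.1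
    simp only at h2
    linarith
  · have h2 {q : ℝ} (hq : qa < q) (hq' : q ≤ qr) : qa * c ≤ q * a := by
      refine (hmono hqa01.1 hq.le hq').trans ?_
      refine mul_le_mul_of_nonneg_left ?_ (h0.trans hq).le
      by_contra! hva
      have hq1 := le_saleProb_valueAtQuantile μ (hq'.trans hqr01.2)
      exact absurd (hq1.trans (saleProb_antitone μ hva.le)) (not_le.2 hq)
    have h3 : Tendsto (fun q => q * a) (𝓝[>] qa) (𝓝 (qa * a)) :=
      ((continuous_id.mul continuous_const).tendsto qa).mono_left nhdsWithin_le_nhds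
    have h4 : qa * c ≤ qa * a := by
      refine ge_of_tendsto h3 ?_
      filter_upwards [Ioc_mem_nhdsGT hlt] with q hq using h2 hq.1 hq.2
    exact absurd h4 (not_le.2 (mul_lt_mul_of_pos_left hac h0))

/-- A regular distribution has an optimal reserve `r` and a nonnegative virtual value, which
vanishes below `r`, is at most the value, and whose integral over `[θ, 1]` is the revenue from the
posted price `θ` for each `θ ≥ r`. -/
theorem IsRegularDistribution.exists_virtualValue (hμ : IsRegularDistribution μ) :
    ∃ (r : I) (ψ : I → ENNReal), IsVirtualValue μ r ψ := by
  obtain ⟨r, hr⟩ := exists_optimal_price μ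
  set ρ : Measure ℝ := μ.map ((↑) : I → ℝ) with hρ
  have hprob : IsProbabilityMeasure ρ :=
    Measure.isProbabilityMeasure_map measurable_subtype_coe.aemeasurable
  have hsale (θ : I) : ENNReal.ofReal θ * μ (Ici θ) = ENNReal.ofReal (θ * saleProb μ θ) := by
    rw [ENNReal.ofReal_mul θ.2.1, saleProb, ofReal_measureReal]
    rfl
  set k : ℝ → ℝ := fun t => t * saleProb μ t with hk
  -- Increments of `f` are the revenue lost by raising the price above `r`; as a measure they will
  -- be the virtual value times the law.
  set f : ℝ → ℝ := fun t => -k (max t r) with hf_def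
  have hr1 : (r : ℝ) ≤ 1 := r.2.2
  have hr0 : (0 : ℝ) ≤ r := r.2.1
  have hkanti {a b : ℝ} (ha : r ≤ a) (hab : a ≤ b) : k b ≤ k a := by
    rcases le_or_gt b 1 with hb | hb
    · exact hμ.mul_saleProb_antitone μ hr ha hab hb
    · have : k b = 0 := by simp [hk, saleProb_of_one_lt μ hb]
      rw [this]
      exact mul_nonneg (hr0.trans ha) (saleProb_nonneg μ a)
  have hf : Monotone f := fun a b hab =>
    neg_le_neg (hkanti (le_max_right _ _) (max_le_max_right _ hab))
  have hfc (t : ℝ) : ContinuousWithinAt f (Iic t) t := by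
    have hk' : ContinuousWithinAt k (Iic (max t r)) (max t r) :=
      continuousWithinAt_id.mul (continuousWithinAt_saleProb μ _)
    have hm : ContinuousWithinAt (fun s => max s (r : ℝ)) (Iic t) t := by fun_prop
    have hmaps : MapsTo (fun s => max s (r : ℝ)) (Iic t) (Iic (max t r)) := fun s hs =>
      max_le_max_right _ (mem_Iic.1 hs)
    exact (ContinuousWithinAt.comp (g := k) (f := fun s => max s (r : ℝ)) (x := t)
      hk' hm hmaps).neg
  -- Domination by the value-weighted law will make the virtual value at most the value.
  set ξ : Measure ℝ := ρ.withDensity (fun t => ENNReal.ofReal (min t 1)) with hξ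
  have hdens : Measurable fun t : ℝ => ENNReal.ofReal (min t 1) := by fun_prop
  have hξfin : IsFiniteMeasure ξ := by
    refine isFiniteMeasure_withDensity (ne_top_of_le_ne_top (b := 1) (by simp) ?_)
    refine (lintegral_mono (g := fun _ => 1) fun t => ?_).trans (by simp)
    exact ENNReal.ofReal_le_one.2 (min_le_right _ _)
  have hle (a b : ℝ) (hab : a < b) : ENNReal.ofReal (f b - f a) ≤ ξ (Ico a b) := by
    rcases le_or_gt b r with hbr | hbr
    · have : f b - f a = 0 := by simp [hf_def, hbr, hab.le.trans hbr]
      simp [this]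
    rcases le_or_gt (max a r) 1 with ha1 | ha1
    swap
    · have h1 : k (max a r) = 0 := by rw [hk]; simp only [saleProb_of_one_lt μ ha1, mul_zero]
      have h2 : k (max b r) = 0 := by
        rw [hk]; simp only [saleProb_of_one_lt μ (ha1.trans_le (max_le_max_right _ hab.le)), mul_zero]
      simp [hf_def, h1, h2]
    set a' := max a r with ha'
    have hra' : r ≤ a' := le_max_right _ _
    have ha'b : a' < b := max_lt hab hbr
    have hfb : f b = -k b := by rw [hf_def]; simp [hbr.le]
    calc ENNReal.ofReal (f b - f a) ≤ ENNReal.ofReal (a' * ρ.real (Ico a' b)) := by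
          refine ENNReal.ofReal_le_ofReal ?_
          have : ρ.real (Ico a' b) = saleProb μ a' - saleProb μ b := by
            rw [saleProb_eq, saleProb_eq, measureReal_Ico_eq ρ ha'b.le]
            ring
          rw [this, hfb, hf_def]
          simp only [hk]
          nlinarith [saleProb_nonneg μ b]
      _ = ∫⁻ _ in Ico a' b, ENNReal.ofReal a' ∂ρ := by
          rw [setLIntegral_const, ENNReal.ofReal_mul (hr0.trans hra'), ofReal_measureReal]
      _ ≤ ∫⁻ t in Ico a' b, ENNReal.ofReal (min t 1) ∂ρ :=
          setLIntegral_mono hdens fun t ht => ENNReal.ofReal_le_ofReal (le_min ht.1 ha1)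
      _ = ξ (Ico a' b) := (withDensity_apply _ measurableSet_Ico).symm
      _ ≤ ξ (Ico a b) := measure_mono (Ico_subset_Ico_left (le_max_left _ _))
  obtain ⟨ν, hνξ, hν⟩ := exists_measure_le_Ico_eq ξ hf hfc hle
  have hνfin : IsFiniteMeasure ν := isFiniteMeasure_of_le ξ hνξ
  have hac : ν ≪ ρ :=
    (Measure.absolutelyContinuous_of_le hνξ).trans (withDensity_absolutelyContinuous _ _)
  have hψle : ∀ᵐ t ∂ρ, ν.rnDeriv ρ t ≤ ENNReal.ofReal (min t 1) := by
    refine ae_le_of_forall_setLIntegral_le_of_sigmaFinite (Measure.measurable_rnDeriv ν ρ)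
      fun s hs _ => ?_
    rw [Measure.setLIntegral_rnDeriv hac, ← withDensity_apply _ hs]
    exact hνξ s
  have hψle' : ∀ᵐ x : I ∂μ, ν.rnDeriv ρ x ≤ ENNReal.ofReal x := by
    have := ae_of_ae_map measurable_subtype_coe.aemeasurable hψle
    filter_upwards [this] with x hx
    exact hx.trans (ENNReal.ofReal_le_ofReal (min_le_left _ _))
  -- The indicator and the minimum turn almost-everywhere properties into pointwise ones.
  refine ⟨r, (Ici r).indicator fun x => min (ν.rnDeriv ρ x) (ENNReal.ofReal x), ?_, ?_, ?_, ?_, ?_⟩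
  · exact (((Measure.measurable_rnDeriv ν ρ).comp measurable_subtype_coe).min
      (measurable_subtype_coe.ennreal_ofReal)).indicator measurableSet_Ici
  · exact fun x => (indicator_le_self _ _ x).trans (min_le_right _ _)
  · exact fun x hx => indicator_of_notMem (not_le.2 hx) _
  · intro θ hθ
    have e1 : ∫⁻ x in Ici θ, (Ici r).indicator
        (fun x => min (ν.rnDeriv ρ x) (ENNReal.ofReal x)) x ∂μ =
        ∫⁻ x in Ici θ, ν.rnDeriv ρ x ∂μ := by
      refine setLIntegral_congr_fun_ae measurableSet_Ici ?_
      filter_upwards [hψle'] with x hx hxθ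
      rw [indicator_of_mem (mem_Ici.2 (hθ.trans hxθ)), min_eq_left hx]
    -- The endpoint 2 lies beyond all values, so the revenue there is zero while an atom at 1 is
    -- still counted.
    have e2 : Ici θ = ((↑) : I → ℝ) ⁻¹' Ico (θ : ℝ) 2 := by
      ext x
      simp only [mem_Ici, mem_preimage, mem_Ico, Subtype.coe_le_coe]
      exact ⟨fun h => ⟨h, x.2.2.trans_lt one_lt_two⟩, fun h => h.1⟩
    have hrθ : (r : ℝ) ≤ θ := hθ
    rw [e1, hsale, e2, ← setLIntegral_map measurableSet_Ico (Measure.measurable_rnDeriv ν ρ)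
      measurable_subtype_coe, Measure.setLIntegral_rnDeriv hac, hν]
    congr 1
    simp [hf_def, hk, hrθ, saleProb_of_one_lt μ one_lt_two, max_eq_left (hr1.trans one_le_two)]
  · intro θ
    rw [hsale, hsale]
    exact ENNReal.ofReal_le_ofReal (hr θ)

end saleProb

/-! ### Virtual surplus of threshold rules -/

namespace IsVirtualValue

open Set Filter Topology

variable {μ : Measure I} [IsProbabilityMeasure μ] {r : I} {ψ : I → ENNReal}

/-- Let the closed threshold decrease to `θ`. Open thresholds occur when ties are lost. -/
theorem setLIntegral_Ioi (h : IsVirtualValue μ r ψ) {θ : I} (hθ : r ≤ θ) :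
    ∫⁻ x in Ioi θ, ψ x ∂μ = ENNReal.ofReal θ * μ (Ioi θ) := by
  rcases eq_or_ne θ 1 with rfl | hne
  · have : Ioi (1 : I) = ∅ := eq_empty_of_forall_notMem fun x hx =>
      absurd unitInterval.le_one' (not_le.2 (mem_Ioi.1 hx))
    simp [this]
  have hlt : θ < 1 := lt_of_le_of_ne unitInterval.le_one' hne
  have hbot : (𝓝[>] θ).NeBot := nhdsGT_neBot_of_exists_gt ⟨1, hlt⟩
  have hfin : IsFiniteMeasure (μ.withDensity ψ) := by
    refine isFiniteMeasure_withDensity (ne_top_of_le_ne_top (b := 1) (by simp) ?_)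
    refine (lintegral_mono (g := fun _ => 1) fun t => ?_).trans (by simp)
    exact (h.le_value t).trans (ENNReal.ofReal_le_one.2 t.2.2)
  have key (x : I) : ∀ᶠ t in 𝓝[>] θ, x ∈ Ici t ↔ x ∈ Ioi θ := by
    by_cases hx : θ < x
    · filter_upwards [mem_nhdsWithin_of_mem_nhds (gt_mem_nhds hx)] with t ht
      exact ⟨fun _ => hx, fun _ => ht.le⟩
    · filter_upwards [self_mem_nhdsWithin] with t ht
      exact ⟨fun hxt => lt_of_lt_of_le (mem_Ioi.1 ht) hxt, fun hxt => absurd hxt hx⟩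
  have h1 := tendsto_measure_of_tendsto_indicator_of_isFiniteMeasure (𝓝[>] θ) (μ.withDensity ψ)
    (fun t => measurableSet_Ici (a := t)) key
  have h2 := tendsto_measure_of_tendsto_indicator_of_isFiniteMeasure (𝓝[>] θ) μ
    (fun t => measurableSet_Ici (a := t)) key
  have h3 : Tendsto (fun t : I => ENNReal.ofReal (t : ℝ)) (𝓝[>] θ) (𝓝 (ENNReal.ofReal (θ : ℝ))) :=
    (ENNReal.continuous_ofReal.comp continuous_subtype_val).continuousAt.tendsto.mono_left
      nhdsWithin_le_nhds
  have h4 := ENNReal.Tendsto.mul h3 (Or.inr (measure_ne_top μ _)) h2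
    (Or.inr ENNReal.ofReal_ne_top)
  rw [← withDensity_apply _ measurableSet_Ioi]
  refine tendsto_nhds_unique (h1.congr' ?_) h4
  filter_upwards [self_mem_nhdsWithin] with t ht
  rw [withDensity_apply _ measurableSet_Ici, h.setLIntegral_Ici t (hθ.trans (mem_Ioi.1 ht).le)]

/-- The revenue of a threshold rule is at most its virtual surplus. -/
theorem volume_compl_mul_le (h : IsVirtualValue μ r ψ) {U : Set I} (hU : IsUpperSet U) :
    volume Uᶜ * μ U ≤ ∫⁻ x in U, ψ x ∂μ := by
  rcases U.eq_empty_or_nonempty with rfl | hne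
  · simp
  obtain ⟨t, ht⟩ : ∃ t : I, IsGLB U t := by
    have hne' : (((↑) : I → ℝ) '' U).Nonempty := hne.image _
    have hbdd : BddBelow (((↑) : I → ℝ) '' U) := ⟨0, by rintro _ ⟨x, -, rfl⟩; exact x.2.1⟩
    have hglb := isGLB_csInf hne' hbdd
    have hmem : sInf (((↑) : I → ℝ) '' U) ∈ I := by
      refine ⟨hglb.2 (by rintro _ ⟨x, -, rfl⟩; exact x.2.1), ?_⟩
      obtain ⟨x, hx⟩ := hne
      exact (hglb.1 ⟨x, hx, rfl⟩).trans x.2.2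
    exact ⟨⟨_, hmem⟩, fun x hx => hglb.1 ⟨x, hx, rfl⟩, fun y hy =>
      hglb.2 (by rintro _ ⟨x, hx, rfl⟩; exact hy hx)⟩
  have hsub : Ioi t ⊆ U := fun x hx => by
    obtain ⟨u, hu, -, hux⟩ := ht.exists_between hx
    exact hU hux.le hu
  have hvol : volume Uᶜ ≤ ENNReal.ofReal t := by
    rw [← unitInterval.volume_Iic]
    exact measure_mono fun x hx => Set.mem_Iic.2 (not_lt.1 fun hlt => hx (hsub hlt))
  refine (mul_le_mul_left hvol _).trans ?_
  rcases le_or_gt r t with hrt | hrt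
  · by_cases htU : t ∈ U
    · have : U = Ici t := Subset.antisymm (fun x hx => ht.1 hx) fun x hx => hU hx htU
      rw [this, h.setLIntegral_Ici t hrt]
    · have : U = Ioi t := Subset.antisymm
        (fun x hx => lt_of_le_of_ne (ht.1 hx) (by rintro rfl; exact htU hx)) hsub
      rw [this, h.setLIntegral_Ioi hrt]
  -- A threshold below `r` earns at most the optimal revenue, which is already the virtual surplus
  -- above `r`.
  · calc ENNReal.ofReal t * μ U ≤ ENNReal.ofReal t * μ (Ici t) :=
          mul_le_mul_right (measure_mono fun x hx => ht.1 hx) _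
      _ ≤ ENNReal.ofReal r * μ (Ici r) := h.optimal t
      _ = ∫⁻ x in Ici r, ψ x ∂μ := (h.setLIntegral_Ici r le_rfl).symm
      _ ≤ ∫⁻ x in U, ψ x ∂μ := lintegral_mono_set fun x hx => hsub (lt_of_lt_of_le hrt hx)

end IsVirtualValue

/-! ### Truthful mechanisms for one bidder -/

section OneBidder

variable {x p : I → ℝ}

theorem monotone_of_truthful (hic : ∀ b c : I, (c : ℝ) * x b - p b ≤ c * x c - p c) :
    Monotone x := by
  intro b c hbc
  rcases hbc.eq_or_lt with rfl | hlt
  · exact le_rfl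
  have h1 := hic b c
  have h2 := hic c b
  have hlt' : (b : ℝ) < c := hlt
  by_contra! hlt
  nlinarith

/-- The rent of a bidder is at least the area under the allocation rule. -/
theorem integral_le_utility {X U : ℝ → ℝ} (hX : Monotone X)
    (hX1 : ∀ t, X t ≤ 1) (hU : Monotone U) (hU0 : ∀ t, 0 ≤ U t) {b : ℝ} (hb0 : 0 ≤ b)
    (hsub : ∀ s t, 0 ≤ s → s ≤ t → t ≤ b → U s + (t - s) * X s ≤ U t) :
    ∫ t in (0 : ℝ)..b, X t ≤ U b := by
  have hXi (s t : ℝ) : IntervalIntegrable X volume s t := hX.intervalIntegrable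
  have hUi (s t : ℝ) : IntervalIntegrable U volume s t := hU.intervalIntegrable
  rcases hb0.eq_or_lt with rfl | hb
  · simpa using hU0 0
  -- Integrating `d * X t ≤ U (t + d) - U t` telescopes, which avoids differentiating `U`; the
  -- leftover strip of width `d` costs at most `d`.
  have key (d : ℝ) (hd : 0 < d) (hdb : d ≤ b) : ∫ t in (0 : ℝ)..b, X t ≤ U b + d := by
    have hUs : IntervalIntegrable (fun t => U (t + d)) volume 0 (b - d) :=
      Monotone.intervalIntegrable fun s t hst => hU (add_le_add_left hst d)
    have h1 : ∫ t in (0 : ℝ)..(b - d), d * X t ≤ ∫ t in (0 : ℝ)..(b - d), (U (t + d) - U t) := by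
      refine intervalIntegral.integral_mono_on (by linarith) ((hXi _ _).const_mul d)
        (hUs.sub (hUi _ _)) fun t ht => ?_
      have := hsub t (t + d) ht.1 (by linarith) (by linarith [ht.2])
      rw [add_sub_cancel_left] at this
      linarith
    rw [intervalIntegral.integral_const_mul, intervalIntegral.integral_sub hUs (hUi _ _),
      intervalIntegral.integral_comp_add_right (fun t => U t), zero_add, sub_add_cancel] at h1
    have h2 : ∫ t in d..b, U t = (∫ t in d..(b - d), U t) + ∫ t in (b - d)..b, U t :=
      (intervalIntegral.integral_add_adjacent_intervals (hUi _ _) (hUi _ _)).symm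
    have h3 : ∫ t in (0 : ℝ)..(b - d), U t = (∫ t in (0 : ℝ)..d, U t) + ∫ t in d..(b - d), U t :=
      (intervalIntegral.integral_add_adjacent_intervals (hUi _ _) (hUi _ _)).symm
    have h4 : 0 ≤ ∫ t in (0 : ℝ)..d, U t :=
      intervalIntegral.integral_nonneg hd.le fun t _ => hU0 t
    have h5 : ∫ t in (b - d)..b, U t ≤ d * U b := by
      calc ∫ t in (b - d)..b, U t ≤ ∫ _ in (b - d)..b, U b :=
            intervalIntegral.integral_mono_on (by linarith) (hUi _ _)
              intervalIntegrable_const fun t ht => hU ht.2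
        _ = d * U b := by simp
    have h6 : ∫ t in (b - d)..b, X t ≤ d := by
      calc ∫ t in (b - d)..b, X t ≤ ∫ _ in (b - d)..b, (1 : ℝ) :=
            intervalIntegral.integral_mono_on (by linarith) (hXi _ _)
              intervalIntegrable_const fun t _ => hX1 t
        _ = d := by simp
    have h7 : ∫ t in (0 : ℝ)..b, X t =
        (∫ t in (0 : ℝ)..(b - d), X t) + ∫ t in (b - d)..b, X t :=
      (intervalIntegral.integral_add_adjacent_intervals (hXi _ _) (hXi _ _)).symm
    have h8 : d * ∫ t in (0 : ℝ)..(b - d), X t ≤ d * U b := by linarith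
    have := le_of_mul_le_mul_left h8 hd
    linarith
  refine le_of_forall_pos_le_add fun d hd => ?_
  exact (key (min d b) (lt_min hd hb) (min_le_right _ _)).trans
    (add_le_add_right (min_le_left _ _) _)

/-- The payment is `b * x b` minus the rent, and the rent is at least the integral of `x` over `[0,
b]`. What remains is the area between `x b` and the allocation curve. -/
theorem ofReal_payment_le (hx0 : ∀ b, 0 ≤ x b) (hx1 : ∀ b, x b ≤ 1)
    (hic : ∀ b c : I, (c : ℝ) * x b - p b ≤ c * x c - p c)
    (hir : ∀ b : I, 0 ≤ (b : ℝ) * x b - p b) (b : I) :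
    ENNReal.ofReal (p b) ≤ ∫⁻ z : I, ENNReal.ofReal (x b - x z) := by
  have hx := monotone_of_truthful hic
  set pr : ℝ → I := Set.projIcc 0 1 zero_le_one with hpr
  have hprm : Monotone pr := Set.monotone_projIcc _
  have hprv {t : ℝ} (h0 : 0 ≤ t) (h1 : t ≤ 1) : (pr t : ℝ) = t := by
    rw [hpr, Set.projIcc_of_mem _ ⟨h0, h1⟩]
  have hprc (z : I) : pr z = z := Set.projIcc_val _ z
  set u : I → ℝ := fun b => b * x b - p b with hu
  have hsub (b c : I) : u b + (c - b) * x b ≤ u c := by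
    have := hic b c
    simp only [hu]
    linarith
  have humono : Monotone u := fun b c hbc => by
    have h1 := hsub b c
    have h2 : 0 ≤ ((c : ℝ) - b) * x b := mul_nonneg (sub_nonneg.2 hbc) (hx0 b)
    linarith
  have hX : Monotone fun t => x (pr t) := hx.comp hprm
  have hrent : ∫ t in (0 : ℝ)..b, x (pr t) ≤ u b := by
    have := integral_le_utility (X := fun t => x (pr t)) (U := fun t => u (pr t)) hX
      (fun t => hx1 _) (humono.comp hprm) (fun t => hir _) b.2.1
      fun s t hs hst htb => by
        have := hsub (pr s) (pr t)
        rwa [hprv hs ((hst.trans htb).trans b.2.2), hprv (hs.trans hst) (htb.trans b.2.2)] at this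
    simpa only [hprc] using this
  have hXi : IntervalIntegrable (fun t => x (pr t)) volume 0 b := hX.intervalIntegrable
  have hmeas : Measurable fun t => ENNReal.ofReal (x b - x (pr t)) :=
    (measurable_const.sub hX.measurable).ennreal_ofReal
  have e : p b ≤ ∫ t in (0 : ℝ)..b, (x b - x (pr t)) := by
    rw [intervalIntegral.integral_sub intervalIntegrable_const hXi,
      intervalIntegral.integral_const, smul_eq_mul, sub_zero]
    simp only [hu] at hrent
    linarith
  calc ENNReal.ofReal (p b) ≤ ENNReal.ofReal (∫ t in (0 : ℝ)..b, (x b - x (pr t))) :=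
        ENNReal.ofReal_le_ofReal e
    _ = ∫⁻ t in Set.Ioc (0 : ℝ) b, ENNReal.ofReal (x b - x (pr t)) := by
        rw [intervalIntegral.integral_of_le b.2.1, ofReal_integral_eq_lintegral_ofReal]
        · exact (intervalIntegrable_iff_integrableOn_Ioc_of_le b.2.1).1
            (intervalIntegrable_const.sub hXi)
        · refine (ae_restrict_iff' measurableSet_Ioc).2 (Filter.Eventually.of_forall fun t ht => ?_)
          have := hX ht.2
          simp only [hprc] at this
          exact sub_nonneg.2 this
    _ ≤ ∫⁻ t in I, ENNReal.ofReal (x b - x (pr t)) :=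
        lintegral_mono_set fun t ht => ⟨ht.1.le, ht.2.trans b.2.2⟩
    _ = ∫⁻ z : I, ENNReal.ofReal (x b - x z) := by
        rw [← unitInterval.measurePreserving_coe.map_eq,
          lintegral_map hmeas measurable_subtype_coe]
        simp only [hprc]

/-- The expected payment of a bidder in a truthful mechanism is at most its expected virtual
surplus. -/
theorem IsVirtualValue.lintegral_payment_le {μ : Measure I} [IsProbabilityMeasure μ] {r : I}
    {ψ : I → ENNReal} (h : IsVirtualValue μ r ψ) (hx0 : ∀ b, 0 ≤ x b) (hx1 : ∀ b, x b ≤ 1)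
    (hic : ∀ b c : I, (c : ℝ) * x b - p b ≤ c * x c - p c)
    (hir : ∀ b : I, 0 ≤ (b : ℝ) * x b - p b) :
    ∫⁻ b, ENNReal.ofReal (p b) ∂μ ≤ ∫⁻ b, ENNReal.ofReal (x b) * ψ b ∂μ := by
  have hx := monotone_of_truthful hic
  have hxm : Measurable x := hx.measurable
  set m : Measure ℝ := volume.restrict (Set.Ioi 0) with hm
  set V : ℝ → ENNReal := fun s => volume {z : I | x z ≤ s} with hV
  have hVm : Measurable V :=
    Monotone.measurable fun s t hst => measure_mono fun z hz => le_trans hz hst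
  -- Layer cake: at each level `s` the allocation becomes the threshold rule `s < x b`, with price
  -- `V s`.
  have step (b : I) : ∫⁻ z : I, ENNReal.ofReal (x b - x z) =
      ∫⁻ s, {s | s < x b}.indicator V s ∂m := by
    have e1 (z : I) : ENNReal.ofReal (x b - x z) =
        ∫⁻ s, ({q : I × ℝ | x q.1 ≤ q.2 ∧ q.2 < x b}.indicator 1 (z, s) : ENNReal) ∂m := by
      have : (fun s => ({q : I × ℝ | x q.1 ≤ q.2 ∧ q.2 < x b}.indicator 1 (z, s) : ENNReal)) =
          (Set.Ico (x z) (x b)).indicator 1 := by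
        ext s
        simp [Set.indicator_apply]
      rw [this, lintegral_indicator_one measurableSet_Ico, hm, restrict_Ioi_eq_restrict_Ici,
        Measure.restrict_apply measurableSet_Ico,
        Set.inter_eq_left.2 (Set.Ico_subset_Ici_self.trans (Set.Ici_subset_Ici.2 (hx0 z))), Real.volume_Ico]
    have hset : MeasurableSet {q : I × ℝ | x q.1 ≤ q.2 ∧ q.2 < x b} :=
      (measurableSet_le (hxm.comp measurable_fst) measurable_snd).inter
        (measurableSet_lt measurable_snd measurable_const)
    simp_rw [e1]
    rw [lintegral_lintegral_swap
      (f := fun z s => ({q : I × ℝ | x q.1 ≤ q.2 ∧ q.2 < x b}.indicator 1 (z, s) : ENNReal))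
      ((measurable_one.indicator hset).aemeasurable)]
    refine lintegral_congr fun s => ?_
    by_cases hs : s < x b
    · have : (fun z => ({q : I × ℝ | x q.1 ≤ q.2 ∧ q.2 < x b}.indicator 1 (z, s) : ENNReal)) =
          {z : I | x z ≤ s}.indicator 1 := by
        ext z
        simp [Set.indicator_apply, hs]
      rw [this, lintegral_indicator_one (measurableSet_le hxm measurable_const),
        Set.indicator_of_mem (by exact hs)]
    · simp [hs]
  calc ∫⁻ b, ENNReal.ofReal (p b) ∂μ
      ≤ ∫⁻ b, ∫⁻ s, {s | s < x b}.indicator V s ∂m ∂μ :=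
        lintegral_mono fun b => (ofReal_payment_le hx0 hx1 hic hir b).trans (step b).le
    _ = ∫⁻ s, ∫⁻ b, {s | s < x b}.indicator V s ∂μ ∂m := by
        refine lintegral_lintegral_swap
          (f := fun b s => ({s | s < x b}.indicator V s : ENNReal)) ?_
        exact ((hVm.comp measurable_snd).indicator
          (measurableSet_lt measurable_snd (hxm.comp measurable_fst) :
            MeasurableSet {q : I × ℝ | q.2 < x q.1})).aemeasurable
    _ = ∫⁻ s, V s * μ {b | s < x b} ∂m := by
        refine lintegral_congr fun s => ?_
        rw [← lintegral_indicator_const (measurableSet_lt measurable_const hxm)]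
        refine lintegral_congr fun b => ?_
        simp [Set.indicator_apply]
    _ ≤ ∫⁻ s, μ.withDensity ψ {b | s < x b} ∂m := by
        refine lintegral_mono fun s => ?_
        have hU : IsUpperSet {b | s < x b} := fun b c hbc hb => lt_of_lt_of_le hb (hx hbc)
        have hc : {b | s < x b}ᶜ = {z | x z ≤ s} := by ext z; simp
        have := h.volume_compl_mul_le hU
        rwa [hc, ← withDensity_apply _ (measurableSet_lt measurable_const hxm)] at this
    _ = ∫⁻ b, ENNReal.ofReal (x b) ∂(μ.withDensity ψ) :=
        (lintegral_eq_lintegral_meas_lt _ (Filter.Eventually.of_forall hx0) hxm.aemeasurable).symm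
    _ = ∫⁻ b, ENNReal.ofReal (x b) * ψ b ∂μ := by
        rw [lintegral_withDensity_eq_lintegral_mul _ h.measurable hxm.ennreal_ofReal]
        exact lintegral_congr fun b => mul_comm _ _

end OneBidder

/-! ### Comparison with arbitrary truthful mechanisms -/

namespace Mechanism

variable {n : ℕ}

theorem IsTruthful.revenue_le_one {h : Mechanism n} (hh : h.IsTruthful) (v : Profile n) :
    h.revenue v ≤ 1 := by
  refine (Finset.sum_le_sum fun i _ => ?_).trans (hh.sum_alloc_le_one v)
  have h1 := hh.individually_rational i v
  have h2 : (v i : ℝ) * h.alloc v i ≤ 1 * h.alloc v i :=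
    mul_le_mul_of_nonneg_right (v i).2.2 (hh.alloc_nonneg v i)
  linarith

theorem bddAbove_truthfulClass (D : Measure (Profile n)) [IsProbabilityMeasure D] :
    BddAbove (expectedRevenue D '' truthfulClass D) := by
  refine ⟨1, ?_⟩
  rintro _ ⟨h, hh, rfl⟩
  exact (integral_mono hh.2 (integrable_const 1) hh.1.revenue_le_one).trans (by simp)

theorem measurable_pay_secondPrice (r : Fin n → I) (i : Fin n) :
    Measurable fun v => (secondPrice r).pay v i := by
  classical
  have h : Measurable fun v : Profile n => (r, v) := measurable_const.prodMk measurable_id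
  exact (measurable_subtype_coe.comp ((measurable_price i).comp h)).ite (h (measurableSet_wins i))
    measurable_const

theorem measurableSet_setOf_wins (r : Fin n → I) (i : Fin n) :
    MeasurableSet {v | Wins r v i} :=
  (measurable_const.prodMk measurable_id : Measurable fun v : Profile n => (r, v))
    (measurableSet_wins i)

theorem integrable_secondPrice_revenue (D : Measure (Profile n)) [IsProbabilityMeasure D]
    (r : Fin n → I) : Integrable (secondPrice r).revenue D :=
  Integrable.of_bound
    (Finset.measurable_sum _ fun i _ => measurable_pay_secondPrice r i).aestronglyMeasurable 1
    (Filter.Eventually.of_forall fun v => by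
      rw [Real.norm_of_nonneg secondPrice_revenue_nonneg]
      exact secondPrice_revenue_le_one)

theorem bddAbove_secondPriceClass (D : Measure (Profile n)) [IsProbabilityMeasure D] :
    BddAbove (expectedRevenue D '' secondPriceClass n) := by
  refine ⟨1, ?_⟩
  rintro _ ⟨_, ⟨r, rfl⟩, rfl⟩
  exact (integral_mono (integrable_secondPrice_revenue D r) (integrable_const 1)
    fun v => secondPrice_revenue_le_one).trans (by simp)

/-- With the other bids fixed, bidder `i` faces a truthful one-bidder mechanism; independence lets
the bound be integrated over the others. -/
theorem IsTruthful.lintegral_pay_le {h : Mechanism n} (hh : h.IsTruthful)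
    (μ : Fin n → Measure I) [∀ i, IsProbabilityMeasure (μ i)] {i : Fin n} {r : I}
    {ψ : I → ENNReal} (hψ : IsVirtualValue (μ i) r ψ) :
    ∫⁻ v, ENNReal.ofReal (h.pay v i) ∂(Measure.pi μ) ≤
      ∫⁻ v, ENNReal.ofReal (h.alloc v i) * ψ (v i) ∂(Measure.pi μ) := by
  refine lintegral_le_of_lmarginal_le {i} (hh.measurable_pay i).ennreal_ofReal
    ((hh.measurable_alloc i).ennreal_ofReal.mul (hψ.measurable.comp (measurable_pi_apply i)))
    fun v => ?_
  rw [lmarginal_singleton, lmarginal_singleton]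
  simp only [Function.update_self]
  refine hψ.lintegral_payment_le (fun b => hh.alloc_nonneg _ i) (fun b => ?_) (fun b c => ?_)
    fun b => ?_
  · exact (Finset.single_le_sum (f := fun j => h.alloc (Function.update v i b) j)
      (fun j _ => hh.alloc_nonneg _ j) (Finset.mem_univ i)).trans (hh.sum_alloc_le_one _)
  · simpa using hh.dominant_strategy i (Function.update v i c) b
  · simpa using hh.individually_rational i (Function.update v i b)

theorem price_update (r : Fin n → I) (v : Profile n) (i : Fin n) (b : I) :
    price r (Function.update v i b) i = price r v i := by
  have hE : (eligible r (Function.update v i b)).erase i = (eligible r v).erase i := by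
    ext j
    simp only [Finset.mem_erase, mem_eligible]
    exact and_congr_right fun hj => by rw [Function.update_of_ne hj]
  rw [price, price, hE]
  congr 1
  exact Finset.sup_congr rfl fun j hj => Function.update_of_ne (Finset.ne_of_mem_erase hj) _ _

theorem wins_of_price_lt {r : Fin n → I} {v : Profile n} {i : Fin n} (h : price r v i < v i) :
    Wins r v i := by
  refine ⟨mem_eligible.2 (le_sup_left.trans h.le), fun j hj => ?_⟩
  rcases eq_or_ne j i with rfl | hji
  · exact Or.inr ⟨rfl, le_rfl⟩
  · exact Or.inl ((le_price hj hji).trans_lt h)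

open Classical in
-- With the other bids fixed, bidder `i` wins exactly above a threshold `θ ≥ r i`, which is also its
-- price. Tie-breaking decides whether `θ` itself wins, and both cases have virtual surplus equal to
-- revenue.
theorem lintegral_secondPrice_pay (μ : Fin n → Measure I) [∀ i, IsProbabilityMeasure (μ i)]
    (r : Fin n → I) {i : Fin n} {ψ : I → ENNReal} (hψ : IsVirtualValue (μ i) (r i) ψ) :
    ∫⁻ v, (if Wins r v i then ψ (v i) else 0) ∂(Measure.pi μ) =
      ∫⁻ v, ENNReal.ofReal ((secondPrice r).pay v i) ∂(Measure.pi μ) := by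
  refine lintegral_eq_of_lmarginal_eq {i}
    ((hψ.measurable.comp (measurable_pi_apply i)).ite
      (measurableSet_setOf_wins r i) measurable_const)
    (measurable_pay_secondPrice r i).ennreal_ofReal ?_
  ext v
  rw [lmarginal_singleton, lmarginal_singleton]
  simp only [Function.update_self]
  set θ := price r v i with hθ
  set W : Set I := {b | Wins r (Function.update v i b) i} with hW
  have hrθ : r i ≤ θ := le_sup_left
  have hWθ (b : I) (hb : b ∈ W) : θ ≤ b := by
    have := Wins.price_le hb
    rwa [price_update, Function.update_self] at this
  have hθW (b : I) (hb : θ < b) : b ∈ W :=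
    wins_of_price_lt (by rwa [price_update, Function.update_self])
  have hcases : W = Set.Ici θ ∨ W = Set.Ioi θ := by
    by_cases hmem : θ ∈ W
    · refine Or.inl (Set.Subset.antisymm hWθ fun b hb => ?_)
      rcases (Set.mem_Ici.1 hb).eq_or_lt with rfl | hlt
      · exact hmem
      · exact hθW b hlt
    · exact Or.inr (Set.Subset.antisymm
        (fun b hb => lt_of_le_of_ne (hWθ b hb) (by rintro rfl; exact hmem hb)) hθW)
  have hWm : MeasurableSet W := by
    rcases hcases with h | h <;> rw [h]
    · exact measurableSet_Ici
    · exact measurableSet_Ioi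
  have e1 : ∫⁻ b, (if Wins r (Function.update v i b) i then ψ b else 0) ∂(μ i) =
      ∫⁻ b in W, ψ b ∂(μ i) := by
    rw [← lintegral_indicator hWm]
    rfl
  have e2 : ∫⁻ b, ENNReal.ofReal ((secondPrice r).pay (Function.update v i b) i) ∂(μ i) =
      ENNReal.ofReal θ * μ i W := by
    rw [← lintegral_indicator_const hWm]
    refine lintegral_congr fun b => ?_
    by_cases hb : Wins r (Function.update v i b) i
    · rw [secondPrice_pay_of_wins hb, price_update, Set.indicator_of_mem (show b ∈ W from hb)]
    · rw [secondPrice_pay_of_not_wins hb, Set.indicator_of_notMem (show b ∉ W from hb),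
        ENNReal.ofReal_zero]
  rw [e1, e2]
  rcases hcases with h | h <;> rw [h]
  · exact hψ.setLIntegral_Ici θ hrθ
  · exact hψ.setLIntegral_Ioi hrθ

open Classical in
/-- Every virtual value is covered by the virtual value of the winner and the price it pays. -/
theorem virtualValue_le {μ : Fin n → Measure I} {r : Fin n → I} {ψ : Fin n → I → ENNReal}
    (hψ : ∀ i, IsVirtualValue (μ i) (r i) (ψ i)) (v : Profile n) (j : Fin n) :
    ψ j (v j) ≤ (∑ i, if Wins r v i then ψ i (v i) else 0) +
      ENNReal.ofReal ((secondPrice r).revenue v) := by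
  rcases lt_or_ge (v j) (r j) with hlt | hge
  · rw [(hψ j).eq_zero _ hlt]
    exact zero_le
  obtain ⟨w, hw⟩ := exists_wins ⟨j, mem_eligible.2 hge⟩
  rcases eq_or_ne j w with rfl | hne
  · refine le_add_right ?_
    refine le_trans ?_ (Finset.single_le_sum
      (f := fun i => if Wins r v i then ψ i (v i) else 0) (fun i _ => zero_le)
      (Finset.mem_univ j))
    simp only [if_pos hw, le_refl]
  · refine le_add_left (((hψ j).le_value _).trans (ENNReal.ofReal_le_ofReal ?_))
    rw [hw.revenue_eq]
    exact le_price (mem_eligible.2 hge) hne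

/-- For regular distributions, the second-price auction with optimal reserves gets at least half
of the revenue of any truthful mechanism. -/
theorem expectedRevenue_le_two_mul (μ : Fin n → Measure I) [∀ i, IsProbabilityMeasure (μ i)]
    {r : Fin n → I} {ψ : Fin n → I → ENNReal} (hψ : ∀ i, IsVirtualValue (μ i) (r i) (ψ i))
    {h : Mechanism n} (hh : h ∈ truthfulClass (Measure.pi μ)) :
    expectedRevenue (Measure.pi μ) h ≤ 2 * expectedRevenue (Measure.pi μ) (secondPrice r) := by
  classical
  set D := Measure.pi μ with hD
  have hrev : ENNReal.ofReal (expectedRevenue D (secondPrice r)) =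
      ∫⁻ v, ENNReal.ofReal ((secondPrice r).revenue v) ∂D :=
    ofReal_integral_eq_lintegral_ofReal (integrable_secondPrice_revenue D r)
      (Filter.Eventually.of_forall fun v => secondPrice_revenue_nonneg)
  have hsp0 : 0 ≤ expectedRevenue D (secondPrice r) :=
    integral_nonneg fun v => secondPrice_revenue_nonneg
  have hwm (i : Fin n) : Measurable fun v => if Wins r v i then ψ i (v i) else 0 :=
    ((hψ i).measurable.comp (measurable_pi_apply i)).ite
      (measurableSet_setOf_wins r i) measurable_const
  have hwin : ∫⁻ v, ∑ i, (if Wins r v i then ψ i (v i) else 0) ∂D =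
      ∫⁻ v, ENNReal.ofReal ((secondPrice r).revenue v) ∂D := by
    rw [lintegral_finsetSum _ fun i _ => hwm i]
    have (v : Profile n) : ENNReal.ofReal ((secondPrice r).revenue v) =
        ∑ i, ENNReal.ofReal ((secondPrice r).pay v i) :=
      ENNReal.ofReal_sum_of_nonneg fun i _ => secondPrice_pay_nonneg
    simp_rw [this]
    rw [lintegral_finsetSum _ fun i _ => (measurable_pay_secondPrice r i).ennreal_ofReal]
    exact Finset.sum_congr rfl fun i _ => lintegral_secondPrice_pay μ r (hψ i)
  have hmain : ∫⁻ v, ENNReal.ofReal (h.revenue v) ∂D ≤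
      ENNReal.ofReal (2 * expectedRevenue D (secondPrice r)) := by
    calc ∫⁻ v, ENNReal.ofReal (h.revenue v) ∂D
        ≤ ∫⁻ v, ∑ i, ENNReal.ofReal (h.pay v i) ∂D :=
          lintegral_mono fun v => Finset.le_sum_of_subadditive ENNReal.ofReal
            ENNReal.ofReal_zero.le (fun _ _ => ENNReal.ofReal_add_le) _ _
      _ = ∑ i, ∫⁻ v, ENNReal.ofReal (h.pay v i) ∂D :=
          lintegral_finsetSum _ fun i _ => (hh.1.measurable_pay i).ennreal_ofReal
      _ ≤ ∑ i, ∫⁻ v, ENNReal.ofReal (h.alloc v i) * ψ i (v i) ∂D :=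
          Finset.sum_le_sum fun i _ => hh.1.lintegral_pay_le μ (hψ i)
      _ = ∫⁻ v, ∑ i, ENNReal.ofReal (h.alloc v i) * ψ i (v i) ∂D :=
          (lintegral_finsetSum _ fun i _ => (hh.1.measurable_alloc i).ennreal_ofReal.mul
            ((hψ i).measurable.comp (measurable_pi_apply i))).symm
      _ ≤ ∫⁻ v, ((∑ i, if Wins r v i then ψ i (v i) else 0) +
            ENNReal.ofReal ((secondPrice r).revenue v)) ∂D := by
          refine lintegral_mono fun v => ?_
          calc ∑ i, ENNReal.ofReal (h.alloc v i) * ψ i (v i)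
              ≤ ∑ i, ENNReal.ofReal (h.alloc v i) *
                  ((∑ i, if Wins r v i then ψ i (v i) else 0) +
                    ENNReal.ofReal ((secondPrice r).revenue v)) :=
                Finset.sum_le_sum fun i _ => mul_le_mul_right (virtualValue_le hψ v i) _
            _ ≤ 1 * ((∑ i, if Wins r v i then ψ i (v i) else 0) +
                    ENNReal.ofReal ((secondPrice r).revenue v)) := by
                rw [← Finset.sum_mul,
                  ← ENNReal.ofReal_sum_of_nonneg fun i _ => hh.1.alloc_nonneg v i]
                exact mul_le_mul_left (ENNReal.ofReal_le_one.2 (hh.1.sum_alloc_le_one v)) _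
            _ = _ := one_mul _
      _ = ENNReal.ofReal (2 * expectedRevenue D (secondPrice r)) := by
          rw [lintegral_add_left (Finset.measurable_sum _ fun i _ => hwm i), hwin, ← hrev,
            ← ENNReal.ofReal_add hsp0 hsp0, two_mul]
  -- Payments may be negative, so only the positive part of the revenue is bounded.
  have hpos : expectedRevenue D h ≤ (∫⁻ v, ENNReal.ofReal (h.revenue v) ∂D).toReal := by
    rw [expectedRevenue, integral_eq_lintegral_pos_part_sub_lintegral_neg_part hh.2]
    exact sub_le_self _ ENNReal.toReal_nonneg
  refine hpos.trans ?_
  exact ENNReal.toReal_le_of_le_ofReal (by positivity) hmain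

theorem half_sSup_truthfulClass_le (μ : Fin n → Measure I) [∀ i, IsProbabilityMeasure (μ i)]
    (hμ : ∀ i, IsRegularDistribution (μ i)) :
    (1 / 2 : ℝ) * sSup (expectedRevenue (Measure.pi μ) '' truthfulClass (Measure.pi μ))
      ≤ sSup (expectedRevenue (Measure.pi μ) '' secondPriceClass n) := by
  choose r ψ hψ using fun i => (hμ i).exists_virtualValue (μ i)
  have hle : expectedRevenue (Measure.pi μ) (secondPrice r) ≤
      sSup (expectedRevenue (Measure.pi μ) '' secondPriceClass n) :=
    le_csSup (bddAbove_secondPriceClass _) ⟨_, ⟨r, rfl⟩, rfl⟩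
  have h0 : 0 ≤ expectedRevenue (Measure.pi μ) (secondPrice r) :=
    integral_nonneg fun v => secondPrice_revenue_nonneg
  have : sSup (expectedRevenue (Measure.pi μ) '' truthfulClass (Measure.pi μ)) ≤
      2 * expectedRevenue (Measure.pi μ) (secondPrice r) := by
    refine Real.sSup_le ?_ (by positivity)
    rintro _ ⟨h, hh, rfl⟩
    exact expectedRevenue_le_two_mul μ hψ hh
  linarith

end Mechanism

theorem mainTheorem4 (n : ℕ)
    (erm : Multiset (Profile n) → (Fin n → unitInterval))
    (hERM : IsERM (fun r v => (Mechanism.secondPrice r).revenue v) erm)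
    (hTie : FavorsSampleValues erm)
    (hMeas : ∀ m : ℕ, Measurable fun S : Fin m → Profile n => erm (sampleOf S)) :
    (∀ m : ℕ, 1 ≤ m → splitSampleGrowth erm m ≤ (m : ℕ∞) ^ n) ∧
    ∀ (μ : Fin n → MeasureTheory.Measure unitInterval)
      [∀ i, MeasureTheory.IsProbabilityMeasure (μ i)]
      (D : MeasureTheory.Measure (Profile n)), D = MeasureTheory.Measure.pi μ →
      BddAbove (Mechanism.expectedRevenue D '' Mechanism.secondPriceClass n) ∧
      BddAbove (Mechanism.expectedRevenue D '' Mechanism.truthfulClass D) ∧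
      (∀ m : ℕ, 1 ≤ m →
        sSup (Mechanism.expectedRevenue D '' Mechanism.secondPriceClass n)
            - √(2 * n * Real.log (2 * m) / m)
          ≤ ∫ S : Fin m → Profile n,
              Mechanism.expectedRevenue D (Mechanism.secondPrice (erm (sampleOf S)))
              ∂(MeasureTheory.Measure.pi fun _ => D)) ∧
      ((∀ i, IsRegularDistribution (μ i)) →
        (1 / 2 : ℝ) * sSup (Mechanism.expectedRevenue D '' Mechanism.truthfulClass D)
          ≤ sSup (Mechanism.expectedRevenue D '' Mechanism.secondPriceClass n) ∧
        ∀ m : ℕ, 1 ≤ m →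
          (1 / 2 : ℝ) * sSup (Mechanism.expectedRevenue D '' Mechanism.truthfulClass D)
              - √(2 * n * Real.log (2 * m) / m)
            ≤ ∫ S : Fin m → Profile n,
                Mechanism.expectedRevenue D (Mechanism.secondPrice (erm (sampleOf S)))
                ∂(MeasureTheory.Measure.pi fun _ => D)) := by
  refine ⟨fun m hm => splitSampleGrowth_le hERM hTie hm, fun μ _ D hD => ?_⟩
  subst hD
  have hlearn (m : ℕ) (hm : 1 ≤ m) := expectedRevenue_erm_ge hERM hTie hm (hMeas m) (Measure.pi μ)
  refine ⟨Mechanism.bddAbove_secondPriceClass _, Mechanism.bddAbove_truthfulClass _, hlearn,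
    fun hμ => ?_⟩
  have hhalf := Mechanism.half_sSup_truthfulClass_le μ hμ
  exact ⟨hhalf, fun m hm => (sub_le_sub_right hhalf _).trans (hlearn m hm)⟩
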